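/- Work on the triangular lattice with horizontal lattice lines. A lozenge is the union of two unit triangles sharing an edge; a lozenge tiling of a region is a covering of it by lozenges without gaps or overlaps, and $\operatorname{M}(R)$ denotes the number of lozenge tilings of the region $R$. **The region.** Let $k,x,t,h,l$ be non-negative integers and let $1\le a_1<a_2<\dots<a_l\le h+l$ be integers. Put $b=h(k+1)+(l-1)k+t$. Take the hexagon with all angles $120^\circ$ and side-lengths $x+h,\ b,\ l,\ x+h,\ b,\ l$ in clockwise order starting from the north side. From the left end of its south side draw the $k$-staircase with $h+l$ steps: first $t$ unit edges in the up-left direction, then $h+l$ unit edges in the up-right direction (the steps, labelled $1,2,\dots,h+l$ from bottom to top), any two consecutive steps being separated by $k$ unit edges in the up-left direction. The staircase ends on the north side, at distance $x$ from its right end. Cut off the part of the hexagon to the left of the staircase, and for each of the $h$ labels $m\in\{1,\dots,h+l\}\setminus\{a_1,\dots,a_l\}$ remove the up-pointing unit triangle whose left edge is the $m$-th step. The resulting region is the $k$-halved hexagon $H_{x,t,h}(a_1,\dots,a_l)$. (If $h=l=0$ there are no steps, and the region is the parallelogram with side-lengths $x$ and $t-k$, which is empty if $t\le k$; an empty region has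 exactly one tiling.) **The formula.** For an integer $n$ let $(y)_n=y(y+1)\cdots(y+n-1)$ if $n>0$, $(y)_0=1$, and $(y)_n=\dfrac{1}{(y-1)(y-2)\cdots(y+n)}$ if $n<0$. With empty products equal to $1$, let $$\begin{aligned}\Phi_{k}((a_i)_{i=1}^{l}; t,x,h)=&\prod_{i=1}^{l}\frac{(x+h+l+1-a_i)_{t+(k+1)a_i-l-k}}{(h+l+1-a_i)_{t+(k+1)a_i-l-k}}\\ &\times \prod_{j=1}^{k-1}\prod_{i=1}^{\lfloor \frac{l+k-j}{k+1}\rfloor}\frac{((k+1)(x+h)+t+k(k+1)i+(j-1)k-(k+1)(k-1))_{j}}{((k+1)h+t+k(k+1)i+(j-1)k-(k+1)(k-1))_{j}}\\ &\times \prod_{i=1}^{\lfloor \frac{l}{k+1}\rfloor}\frac{((k+1)(x+h)+t+k(k+1)i-k+1)_{(k+1)l+k-(k+1)^2i}}{((k+1)h+t+k(k+1)i-k+1)_{(k+1)l+k-(k+1)^2i}}.\end{aligned}$$ **Theorem.** For all non-negative integers $k,x,t,h,l$ and all integers $1\le a_1<a_2<\dots<a_l\le h+l$, $$\operatorname{M}(H_{x,t,h}(a_1,\dots,a_l))=\Phi_{k}((a_j)_{j=1}^{l};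 t,x,h)\prod_{i=1}^{l}\Phi_{k}((a_j)_{j=1}^{i}; t,\,a_{i+1}-a_{i}-1,\,a_{i}-i),$$ where $a_{l+1}=l+h+1$ by convention. -/

import Mathlib

namespace HalvedHexagon

/-- The unit triangles of the triangular lattice. The pair `(i, j) : ℤ × ℤ` stands for the lattice
point `i • e + j • f`, where `e` is the unit vector pointing east and `f` is `e` rotated
counterclockwise by 60 degrees; thus `j` is the height of the point, and the unit step up-left
changes `(i, j)` into `(i - 1, j + 1)`. -/
inductive UnitTriangle
  /-- The up-pointing triangle with lower left corner `(i, j)`. -/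
  | up (i j : ℤ)
  /-- The down-pointing triangle with upper right corner `(i + 1, j + 1)`. -/
  | down (i j : ℤ)
  deriving DecidableEq

/-- The three corners of a unit triangle. -/
def UnitTriangle.vertices : UnitTriangle → Finset (ℤ × ℤ)
  | .up i j => {(i, j), (i + 1, j), (i, j + 1)}
  | .down i j => {(i + 1, j), (i, j + 1), (i + 1, j + 1)}

/-- A lozenge is the union of two unit triangles that share an edge (two of their corners). -/
def IsLozenge (L : Finset UnitTriangle) : Prop :=
  ∃ p q : UnitTriangle, (p.vertices ∩ q.vertices).card = 2 ∧ L = {p, q}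

/-- A lozenge tiling of a region (a set of unit triangles): a collection of lozenges inside the
region that do not overlap and leave no gap. -/
structure IsTiling (R : Set UnitTriangle) (T : Finset (Finset UnitTriangle)) : Prop where
  isLozenge : ∀ L ∈ T, IsLozenge L
  subset : ∀ L ∈ T, ∀ p ∈ L, p ∈ R
  disjoint : ∀ L ∈ T, ∀ L' ∈ T, L ≠ L' → Disjoint L L'
  cover : ∀ p ∈ R, ∃ L ∈ T, p ∈ L

/-- The number of lozenge tilings of a region. -/
noncomputable def tilingCount (R : Set UnitTriangle) : ℕ :=
  Nat.card {T : Finset (Finset UnitTriangle) // IsTiling R T}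

/-- The lattice points of the hexagon with 120 degree angles and side lengths
`w, b, c, w, b, c` in clockwise order from the north side (so the southwest side has length `b` and
the northwest side has length `c`), with the left end of the south side at the origin. -/
def hexagonPoints (w b c : ℤ) : Set (ℤ × ℤ) :=
  {p | 0 ≤ p.2 ∧ p.2 ≤ b + c ∧ -b ≤ p.1 ∧ p.1 ≤ w ∧ 0 ≤ p.1 + p.2 ∧ p.1 + p.2 ≤ w + c}

/-- The height of the lower end of the `m`-th step of the staircase (`m ≥ 1`). The staircase starts
at the origin with `t` unit edges going up-left; then come the steps, which are unit edges going
up-right, and two consecutive steps are separated by `k` unit edges going up-left. -/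
def stepHeight (k t : ℕ) (m : ℕ) : ℤ :=
  t + ((m : ℤ) - 1) * (k + 1)

/-- The number of edges of the `k`-staircase with `n` steps that go up-right and lie below
height `j`. As every other edge below height `j` goes up-left, the staircase meets height `j` in
the point `(stepsBelow k t n j - j, j)`. -/
def stepsBelow (k t n : ℕ) (j : ℤ) : ℕ :=
  ((Finset.Icc 1 n).filter fun m => stepHeight k t m < j).card

/-- The lattice points on the staircase or to the right of it. -/
def rightOfStaircase (k t n : ℕ) : Set (ℤ × ℤ) :=
  {p | (stepsBelow k t n p.2 : ℤ) - p.2 ≤ p.1}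

/-- The up-pointing unit triangle whose left edge is the `m`-th step of the staircase. -/
def dent (k t m : ℕ) : UnitTriangle :=
  .up ((m : ℤ) - 1 - stepHeight k t m) (stepHeight k t m)

/-- The `k`-halved hexagon `H_{x,t,h}(a₁, …, a_l)`: the hexagon of side lengths
`x + h, h(k+1) + (l-1)k + t, l, x + h, h(k+1) + (l-1)k + t, l`, from which the part to the left of
the `k`-staircase with `h + l` steps is cut off and from which the dents at the steps with labels
different from `a₁, …, a_l` are removed. -/
def halvedHexagon (k x t h l : ℕ) (a : ℕ → ℕ) : Set UnitTriangle :=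
  {p | (∀ v ∈ p.vertices,
          v ∈ hexagonPoints (x + h) (h * (k + 1) + ((l : ℤ) - 1) * k + t) l ∧
          v ∈ rightOfStaircase k t (h + l)) ∧
       ∀ m ∈ Finset.Icc 1 (h + l), (∀ i ∈ Finset.Icc 1 l, m ≠ a i) → p ≠ dent k t m}

/-- The Pochhammer symbol `(x)_n` for an integer `n`: it is `x (x+1) ⋯ (x+n-1)` for `n ≥ 0` and
`1 / ((x-1) (x-2) ⋯ (x+n))` for `n < 0`. -/
def poch (x : ℚ) : ℤ → ℚ
  | .ofNat n => ∏ m ∈ Finset.range n, (x + m)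
  | .negSucc n => 1 / ∏ m ∈ Finset.range (n + 1), (x - (m + 1))

/-- The function `Φ_k((a_i)_{i=1}^l; t, x, h)`. -/
def Phi (k : ℕ) (a : ℕ → ℕ) (l : ℕ) (t x h : ℤ) : ℚ :=
  (∏ i ∈ Finset.Icc 1 l,
      poch (x + h + l + 1 - a i) (t + (k + 1) * a i - l - k) /
        poch (h + l + 1 - a i) (t + (k + 1) * a i - l - k)) *
  (∏ j ∈ Finset.Icc 1 (k - 1), ∏ i ∈ Finset.Icc 1 ((l + k - j) / (k + 1)),
      poch ((k + 1) * (x + h) + t + k * (k + 1) * i + (j - 1) * k - (k + 1) * (k - 1)) j /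
        poch ((k + 1) * h + t + k * (k + 1) * i + (j - 1) * k - (k + 1) * (k - 1)) j) *
  (∏ i ∈ Finset.Icc 1 (l / (k + 1)),
      poch ((k + 1) * (x + h) + t + k * (k + 1) * i - k + 1)
          ((k + 1) * l + k - (k + 1) ^ 2 * i) /
        poch ((k + 1) * h + t + k * (k + 1) * i - k + 1)
          ((k + 1) * l + k - (k + 1) ^ 2 * i))

end HalvedHexagon

/-! The lattice lines parallel to the steps cut the region into strips, strip `i` lying between the
lines `i` and `i + 1`. In a tiling, the lozenges contained in a single strip form `l`
nonintersecting paths: going left, a path crosses one strip per lozenge and keeps its height or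
gains 1. The paths start at the `l` edges of the southeast side and end at the steps `a 1, …, a l`;
the `j`-th has `N = x + h + t + k (a j - 1)` lozenges and ends at height `s = t + (k + 1) (a j -
1)`. Hence the count should be the Lindström–Gessel–Viennot determinant of the binomials `C(N, s -
r)`, `0 ≤ r < l`.

This is proved by recursion instead of a sign-reversing involution. The paths are followed back
strip by strip and, within a strip, one by one from the lowest. Each single step has two
alternatives, which match Pascal's rule in one column of the determinant. An impossible alternative
(two paths colliding, or a path leaving the region) gives a determinant with two equal columns or a
zero column. The outcome is `IsPathRegion.tilingCount_eq_pathDet`.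

To evaluate the determinant, a factor is taken out of every column; what remains are polynomials in
`a j` of degree less than `l`. Such a determinant is a constant times a Vandermonde determinant, and
evaluation at `y + 1, …, y + l`, where the matrix is triangular, gives the constant. So
`pathDet_eq_tilingProd` yields the single product `tilingProd` with `y = x + h`.

Finally, `Phi` is the quotient of the values of `tilingProd` at `y = x + h` and `y = h`
(`Phi_mul_tilingProd`). When the last step used is the topmost one and `y = a l - l`, the last path
can be dropped (`tilingProd_succ`). Alternating these two facts makes the product of the `Phi`
telescope (`prod_Phi_eq_tilingProd`). -/

namespace HalvedHexagon

open Finset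

/-! ### Pochhammer symbols and the telescoping of the product formula -/

/-- The quotient of factorials as a Pochhammer symbol of possibly negative length. -/
lemma poch_eq_factorial_div (p q : ℕ) :
    poch ((p : ℚ) + 1) ((q : ℤ) - p) = (q.factorial : ℚ) / p.factorial := by
  rcases le_or_gt p q with hpq | hpq
  · obtain ⟨n, rfl⟩ := Nat.exists_eq_add_of_le hpq
    have e : ((p + n : ℕ) : ℤ) - p = Int.ofNat n := by simp
    rw [e, poch, eq_div_iff (by positivity)]
    induction n with
    | zero => simp
    | succ n ih =>
      rw [prod_range_succ, mul_right_comm, ih (by omega) (by simp), ← add_assoc,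
        Nat.factorial_succ]
      push_cast
      ring
  · obtain ⟨n, rfl⟩ := Nat.exists_eq_add_of_lt hpq
    have e : (q : ℤ) - ((q + n + 1 : ℕ) : ℤ) = Int.negSucc n := by
      rw [Int.negSucc_eq]; push_cast; ring
    rw [e, poch]
    have key : ∀ n : ℕ, (∏ m ∈ range n, (((q + n : ℕ) : ℚ) + 1 - (m + 1))) * q.factorial =
        (q + n).factorial := by
      intro n
      induction n with
      | zero => simp
      | succ n ih =>
        rw [prod_range_succ', ← add_assoc, Nat.factorial_succ]
        push_cast at ih ⊢
        rw [← ih, Finset.prod_congr rfl (g := fun m : ℕ => (q : ℚ) + n + 1 - (m + 1))]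
        · ring
        · intro m _
          ring
    have := key (n + 1)
    rw [← add_assoc] at this
    rw [← this]
    have hq : (q.factorial : ℚ) ≠ 0 := by positivity
    have hne : ((q + n + 1).factorial : ℚ) ≠ 0 := by positivity
    rw [← this] at hne
    have hp := left_ne_zero_of_mul hne
    field_simp

/-- The product of `Y + (k + 1) j - i` over `1 ≤ i ≤ j < l`. -/
def triangleProd (k l : ℕ) (Y : ℚ) : ℚ :=
  ∏ j ∈ range l, ∏ i ∈ range j, (Y + (k + 1) * j - (i + 1))

@[simp]
lemma poch_zero (y : ℚ) : poch y 0 = 1 := by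
  change ∏ m ∈ range 0, (y + m) = 1
  simp

lemma poch_natCast (y : ℚ) (n : ℕ) : poch y n = ∏ m ∈ range n, (y + m) := rfl

lemma poch_add (y : ℚ) (m n : ℕ) : poch y (m + n : ℕ) = poch y m * poch (y + m) n := by
  simp only [poch_natCast, prod_range_add]
  congr 1
  refine prod_congr rfl fun i _ => ?_
  push_cast
  ring

/-- The row `j` of `triangleProd` is a Pochhammer symbol. -/
lemma prod_range_sub_eq_poch (k j : ℕ) (Y : ℚ) :
    ∏ i ∈ range j, (Y + (k + 1) * j - (i + 1)) = poch (Y + k * j) j := by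
  rw [poch_natCast, ← prod_range_reflect]
  refine prod_congr rfl fun i hi => ?_
  have : i + 1 ≤ j := mem_range.1 hi
  rw [Nat.sub_sub, Nat.add_comm 1, Nat.cast_sub this]
  push_cast
  ring

/-- The second factor of `Phi`, as a function of its base point. -/
def shortProd (k l : ℕ) (Y : ℚ) : ℚ :=
  ∏ j ∈ Icc 1 (k - 1), ∏ i ∈ Icc 1 ((l + k - j) / (k + 1)),
    poch (Y - 1 + k * (k + 1) * i + (j - 1) * k - (k + 1) * (k - 1)) j

/-- The third factor of `Phi`, as a function of its base point. -/
def longProd (k l : ℕ) (Y : ℚ) : ℚ :=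
  ∏ i ∈ Icc 1 (l / (k + 1)),
    poch (Y + k * (k + 1) * i - k) ((k + 1) * l + k - (k + 1) ^ 2 * i)

/-- Write `l = (k + 1) q + r` with `0 ≤ r ≤ k`. Passing to `l + 1` changes the range of `i` only for
`j = r`, where `i = q + 1` is added; no such `j` exists when `r = 0` or `r = k`. -/
lemma shortProd_succ (k l : ℕ) (Y : ℚ) :
    shortProd k (l + 1) Y = shortProd k l Y *
      if l % (k + 1) = k then 1 else poch (Y + k * l) (l % (k + 1) : ℕ) := by
  set q := l / (k + 1) with hq
  set r := l % (k + 1) with hr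
  have hl : l = (k + 1) * q + r := (Nat.div_add_mod l (k + 1)).symm
  have hrk : r < k + 1 := Nat.mod_lt _ (by omega)
  have step : ∀ j ∈ Icc 1 (k - 1), ∏ i ∈ Icc 1 ((l + 1 + k - j) / (k + 1)),
      poch (Y - 1 + k * (k + 1) * i + (j - 1) * k - (k + 1) * (k - 1)) j =
      (∏ i ∈ Icc 1 ((l + k - j) / (k + 1)),
      poch (Y - 1 + k * (k + 1) * i + (j - 1) * k - (k + 1) * (k - 1)) j) *
      if j = r then poch (Y + k * l) (r : ℕ) else 1 := by
    intro j hj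
    rw [mem_Icc] at hj
    split_ifs with hjr
    · subst hjr
      have e1 : (l + 1 + k - r) / (k + 1) = q + 1 := by
        rw [show l + 1 + k - r = (k + 1) * (q + 1) by
          rw [hl, Nat.mul_add (k + 1) q 1]; omega]
        exact Nat.mul_div_cancel_left _ (by omega)
      have e2 : (l + k - r) / (k + 1) = q := by
        rw [show l + k - r = k + (k + 1) * q by rw [hl]; omega,
          Nat.add_mul_div_left _ _ (by omega), Nat.div_eq_of_lt (by omega), zero_add]
      rw [e1, e2, prod_Icc_succ_top (Nat.le_add_left 1 _)]
      congr 2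
      rw [hl]
      push_cast
      ring
    · rw [mul_one]
      congr 2
      rcases lt_or_gt_of_ne hjr with h | h
      · have e1 : (l + 1 + k - j) / (k + 1) = q + 1 := by
          rw [show l + 1 + k - j = (r - j) + (k + 1) * (q + 1) by
            rw [hl, Nat.mul_add (k + 1) q 1]; omega,
            Nat.add_mul_div_left _ _ (by omega), Nat.div_eq_of_lt (by omega), zero_add]
        have e2 : (l + k - j) / (k + 1) = q + 1 := by
          rw [show l + k - j = (r - j - 1) + (k + 1) * (q + 1) by
            rw [hl, Nat.mul_add (k + 1) q 1]; omega,
            Nat.add_mul_div_left _ _ (by omega), Nat.div_eq_of_lt (by omega), zero_add]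
        rw [e1, e2]
      · have e1 : (l + 1 + k - j) / (k + 1) = q := by
          rw [show l + 1 + k - j = (k + 1 + r - j) + (k + 1) * q by rw [hl]; omega,
            Nat.add_mul_div_left _ _ (by omega), Nat.div_eq_of_lt (by omega), zero_add]
        have e2 : (l + k - j) / (k + 1) = q := by
          rw [show l + k - j = (k + r - j) + (k + 1) * q by rw [hl]; omega,
            Nat.add_mul_div_left _ _ (by omega), Nat.div_eq_of_lt (by omega), zero_add]
        rw [e1, e2]
  unfold shortProd
  rw [prod_congr rfl step, prod_mul_distrib, prod_ite_eq']
  congr 1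
  rcases Nat.eq_zero_or_pos r with h0 | h0
  · simp [h0]
  · by_cases hk : r = k
    · rw [if_neg (by rw [mem_Icc]; omega), if_pos hk]
    · rw [if_pos (by rw [mem_Icc]; omega), if_neg hk]

/-- Each of the `q = l / (k + 1)` old Pochhammer symbols grows by `k + 1` factors at its upper end,
and these blocks join to one run of `(k + 1) q` consecutive factors. If `l % (k + 1) = k`, one more
symbol, of length `k`, appears. -/
lemma longProd_succ (k l : ℕ) (Y : ℚ) :
    longProd k (l + 1) Y = longProd k l Y *
      (if l % (k + 1) = k then poch (Y + k * l) (k : ℕ) else 1) *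
      poch (Y + k * l + (l % (k + 1) : ℕ)) ((k + 1) * (l / (k + 1)) : ℕ) := by
  set q := l / (k + 1) with hq
  set r := l % (k + 1) with hr
  have hl : l = (k + 1) * q + r := (Nat.div_add_mod l (k + 1)).symm
  have hrk : r < k + 1 := Nat.mod_lt _ (by omega)
  have hold : ∏ i ∈ Icc 1 q, poch (Y + k * (k + 1) * i - k)
      ((k + 1) * ((l + 1 : ℕ) : ℤ) + k - (k + 1) ^ 2 * i) =
      longProd k l Y * poch (Y + k * l + (r : ℕ)) ((k + 1) * q : ℕ) := by
    have e : poch (Y + k * l + (r : ℕ)) ((k + 1) * q : ℕ) =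
        ∏ i ∈ Icc 1 q, poch (Y + (k + 1) * l - (k + 1) * i) (k + 1 : ℕ) := by
      have hY : Y + k * l + r = Y + (k + 1) * l - (k + 1) * q := by rw [hl]; push_cast; ring
      rw [hY]
      clear_value q
      clear hY hl hq
      induction q with
      | zero => simp
      | succ q ih =>
        rw [prod_Icc_succ_top (Nat.le_add_left 1 _), ← ih, Nat.mul_succ, Nat.add_comm ((k + 1) * q), poch_add,
          mul_comm]
        congr 2
        push_cast
        ring
    rw [e, longProd, ← hq, ← prod_mul_distrib]
    refine prod_congr rfl fun i hi => ?_
    rw [mem_Icc] at hi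
    have h1 : (k + 1) * i ≤ l := by
      have := Nat.mul_le_mul_left (k + 1) hi.2
      omega
    obtain ⟨d, hd⟩ := Nat.exists_eq_add_of_le h1
    have e1 : (k + 1) * (l : ℤ) + k - (k + 1) ^ 2 * i = (((k + 1) * d + k : ℕ) : ℤ) := by
      rw [hd]; push_cast; ring
    have e2 : (k + 1) * ((l + 1 : ℕ) : ℤ) + k - (k + 1) ^ 2 * i =
        (((k + 1) * d + k + (k + 1) : ℕ) : ℤ) := by
      rw [hd]; push_cast; ring
    rw [e1, e2, poch_add]
    congr 2
    rw [hd]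
    push_cast
    ring
  rw [mul_right_comm, ← hold]
  unfold longProd
  split_ifs with h
  · have e1 : (l + 1) / (k + 1) = q + 1 := by
      rw [show l + 1 = (k + 1) * (q + 1) by rw [hl, h]; ring]
      exact Nat.mul_div_cancel_left _ (by omega)
    rw [e1, prod_Icc_succ_top (Nat.le_add_left 1 _)]
    have e2 : (k + 1) * ((l + 1 : ℕ) : ℤ) + k - (k + 1) ^ 2 * ((q + 1 : ℕ) : ℤ) = (k : ℕ) := by
      rw [hl, h]; push_cast; ring
    rw [e2]
    congr 2
    rw [hl, h]
    push_cast
    ring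
  · have e1 : (l + 1) / (k + 1) = q := by
      rw [show l + 1 = (r + 1) + (k + 1) * q by rw [hl]; ring,
        Nat.add_mul_div_left _ _ (by omega), Nat.div_eq_of_lt (by omega), zero_add]
    rw [e1, mul_one]

/-- Row `l` of the triangle is a run of `l` consecutive factors. Its first `l % (k + 1)` factors
enter the short product, or the long one if their number is `k`; the remaining ones always enter the
long product. -/
lemma triangleProd_eq (k l : ℕ) (Y : ℚ) :
    triangleProd k l Y = shortProd k l Y * longProd k l Y := by
  induction l with
  | zero =>
    have h : ∀ j ∈ Icc 1 (k - 1), (0 + k - j) / (k + 1) = 0 := fun j _ =>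
      Nat.div_eq_of_lt (by omega)
    rw [shortProd, prod_eq_one fun j hj => by rw [h j hj]; simp]
    simp [triangleProd, longProd]
  | succ l ih =>
    have hl : l % (k + 1) + (k + 1) * (l / (k + 1)) = l := Nat.mod_add_div l (k + 1)
    have e : poch (Y + k * l) l = poch (Y + k * l) (l % (k + 1) : ℕ) *
        poch (Y + k * l + (l % (k + 1) : ℕ)) ((k + 1) * (l / (k + 1)) : ℕ) := by
      rw [← poch_add, hl]
    rw [shortProd_succ, longProd_succ, triangleProd, prod_range_succ, ← triangleProd, ih,
      prod_range_sub_eq_poch, e]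
    split_ifs with h
    · rw [h]; ring
    · ring

/-- The product formula for the number of tilings of a `k`-halved hexagon with south side `y`. -/
def tilingProd (k t : ℕ) (a : ℕ → ℕ) (l y : ℕ) : ℚ :=
  (∏ i ∈ Icc 1 l, ((y + t + k * (a i - 1)).factorial : ℚ) / (y + l - a i).factorial) *
    (∏ i ∈ Icc 1 l, ((t + (k + 1) * (a i - 1)).factorial : ℚ)⁻¹) *
    (∏ j ∈ range l, ∏ i ∈ range j, ((a (j + 1) : ℚ) - a (i + 1))) *
    triangleProd k l ((k + 1) * y + t + 1)

lemma triangleProd_pos (k l : ℕ) (Y : ℚ) (hY : 0 < Y) : 0 < triangleProd k l Y := by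
  refine prod_pos fun j _ => prod_pos fun i hi => ?_
  have h1 : (i : ℚ) + 1 ≤ j := by exact_mod_cast mem_range.1 hi
  have h2 : (0 : ℚ) ≤ k * j := by positivity
  linarith

/-- Only the first and the last factor of `tilingProd` depend on `y`, and `Phi` is the quotient of
their values at `x + h` and `h`. The bound `a i ≤ h + l` makes every natural subtraction exact. -/
lemma Phi_mul_tilingProd (k t : ℕ) (a : ℕ → ℕ) (l x h : ℕ)
    (ha : ∀ i ∈ Icc 1 l, 1 ≤ a i ∧ a i ≤ h + l) :
    Phi k a l t x h * tilingProd k t a l h = tilingProd k t a l (x + h) := by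
  have h1 : ∀ y : ℕ, h ≤ y → ∀ i ∈ Icc 1 l,
      poch ((y : ℚ) + l + 1 - a i) ((t : ℤ) + (k + 1) * a i - l - k) =
        ((y + t + k * (a i - 1)).factorial : ℚ) / (y + l - a i).factorial := by
    intro y hy i hi
    obtain ⟨h1, h2⟩ := ha i hi
    rw [← poch_eq_factorial_div]
    have : a i ≤ y + l := by omega
    rw [Nat.cast_sub (R := ℚ) this, Nat.cast_sub (R := ℤ) this]
    push_cast [h1]
    congr 1 <;> ring
  have hP : Phi k a l t x h =
      (∏ i ∈ Icc 1 l, ((x + h + t + k * (a i - 1)).factorial : ℚ) / (x + h + l - a i).factorial) /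
      (∏ i ∈ Icc 1 l, ((h + t + k * (a i - 1)).factorial : ℚ) / (h + l - a i).factorial) *
      (triangleProd k l ((k + 1) * (x + h : ℕ) + t + 1) /
        triangleProd k l ((k + 1) * h + t + 1)) := by
    rw [triangleProd_eq, triangleProd_eq, mul_div_mul_comm, ← mul_assoc, Phi]
    simp only [prod_div_distrib, shortProd, longProd]
    push_cast
    congr 1
    · congr 1
      · simp only [← prod_div_distrib]
        refine prod_congr rfl fun i hi => ?_
        rw [← h1 h le_rfl i hi, ← h1 (x + h) (by omega) i hi]
        push_cast
        rfl
      · congr 1 <;>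
        · refine prod_congr rfl fun j _ => prod_congr rfl fun i _ => ?_
          congr 1
          ring
    · congr 1 <;>
      · refine prod_congr rfl fun i _ => ?_
        congr 1
        ring
  have n1 : ∏ i ∈ Icc 1 l, ((h + t + k * (a i - 1)).factorial : ℚ) / (h + l - a i).factorial ≠ 0 :=
    prod_ne_zero_iff.2 fun i _ => by positivity
  have n2 : triangleProd k l ((k + 1) * h + t + 1) ≠ 0 :=
    (triangleProd_pos k l _ (by positivity)).ne'
  rw [hP, tilingProd, tilingProd]
  generalize triangleProd k l ((k + 1) * h + t + 1) = T at *
  generalize ∏ i ∈ Icc 1 l, ((h + t + k * (a i - 1)).factorial : ℚ) / (h + l - a i).factorial = U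
    at *
  field_simp

lemma prod_Icc_one_eq_prod_range {M : Type*} [CommMonoid M] (l : ℕ) (f : ℕ → M) :
    ∏ i ∈ Icc 1 l, f i = ∏ i ∈ range l, f (i + 1) := by
  induction l with
  | zero => simp
  | succ l ih => rw [prod_Icc_succ_top (Nat.le_add_left 1 _), prod_range_succ, ih]

/-- If the last step carries a path and the north side has length zero, then the topmost path is
forced. -/
lemma tilingProd_succ (k t : ℕ) (a : ℕ → ℕ) (l y : ℕ) (hy : a (l + 1) = y + l + 1)
    (ha : ∀ i ∈ Icc 1 l, a i < a (l + 1)) :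
    tilingProd k t a (l + 1) y = tilingProd k t a l y := by
  -- Since `a (l + 1) = y + l + 1`, raising `l` enlarges each factorial in the denominator by the
  -- factor `a (l + 1) - a i`; together these cancel the new differences in the third factor.
  have e1 : ∏ i ∈ Icc 1 l, (((y + t + k * (a i - 1)).factorial : ℚ) / (y + (l + 1) - a i).factorial)
      = (∏ i ∈ Icc 1 l, (((y + t + k * (a i - 1)).factorial : ℚ) / (y + l - a i).factorial)) /
        ∏ i ∈ range l, ((a (l + 1) : ℚ) - a (i + 1)) := by
    rw [← prod_Icc_one_eq_prod_range l fun i => ((a (l + 1) : ℚ) - a i), ← prod_div_distrib]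
    refine prod_congr rfl fun i hi => ?_
    have := ha i hi
    rw [div_div, show y + (l + 1) - a i = y + l - a i + 1 by omega, Nat.factorial_succ, hy]
    have h2 : a i ≤ y + l := by omega
    push_cast [h2]
    ring
  -- The new row of `triangleProd` extends the numerator factorial of the last path to exactly the
  -- factorial inverted in the second factor.
  have e2 : (∏ i ∈ range l, ((k + 1) * (y : ℚ) + t + 1 + (k + 1) * l - (i + 1))) *
      ((y + t + k * (y + l)).factorial : ℚ) = (t + (k + 1) * (y + l)).factorial := by
    rw [prod_range_sub_eq_poch,
      show (k + 1) * (y : ℚ) + t + 1 + k * l = ((y + t + k * (y + l) : ℕ) : ℚ) + 1 by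
        push_cast; ring,
      show ((l : ℕ) : ℤ) = ((t + (k + 1) * (y + l) : ℕ) : ℤ) - (y + t + k * (y + l) : ℕ) by
        push_cast; ring, poch_eq_factorial_div]
    exact div_mul_cancel₀ _ (by positivity)
  have n1 : ∏ i ∈ range l, ((a (l + 1) : ℚ) - a (i + 1)) ≠ 0 := by
    refine prod_ne_zero_iff.2 fun i hi => ?_
    have := ha (i + 1) (mem_Icc.2 ⟨by omega, mem_range.1 hi⟩)
    have : (a (i + 1) : ℚ) < a (l + 1) := by exact_mod_cast this
    linarith
  have n2 : ((t + (k + 1) * (y + l)).factorial : ℚ) ≠ 0 := by positivity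
  simp only [tilingProd, triangleProd]
  rw [prod_Icc_succ_top (Nat.le_add_left 1 _), prod_Icc_succ_top (Nat.le_add_left 1 _),
    prod_range_succ, prod_range_succ, e1, show a (l + 1) - 1 = y + l by omega,
    show y + (l + 1) - a (l + 1) = 0 by omega, Nat.factorial_zero]
  rw [← e2] at n2 ⊢
  generalize ∏ i ∈ range l, ((a (l + 1) : ℚ) - a (i + 1)) = V at *
  have n3 := left_ne_zero_of_mul n2
  have n4 := right_ne_zero_of_mul n2
  generalize ∏ i ∈ range l, ((k + 1) * (y : ℚ) + t + 1 + (k + 1) * l - (i + 1)) = W at *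
  push_cast
  field_simp

/-- At `y = a (m + 1) - (m + 1)` the path number `m + 1` can be added for free by `tilingProd_succ`;
the next `Phi` then moves `y` to `a (m + 2) - (m + 2)`. -/
lemma prod_Phi_eq_tilingProd (k t : ℕ) (a : ℕ → ℕ) (l : ℕ)
    (ha : StrictMonoOn a (Set.Icc 1 (l + 1))) (ha1 : 1 ≤ a 1) :
    ∏ i ∈ Icc 1 l, Phi k a i t ((a (i + 1) : ℤ) - a i - 1) ((a i : ℤ) - i) =
      tilingProd k t a l (a (l + 1) - (l + 1)) := by
  have hge : ∀ i, 1 ≤ i → i ≤ l + 1 → i ≤ a i := by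
    intro i hi
    induction i, hi using Nat.le_induction with
    | base => exact fun _ => ha1
    | succ i hi ih =>
      intro h
      have := ih (by omega)
      have := ha (a := i) (b := i + 1) ⟨hi, by omega⟩ ⟨by omega, h⟩ (by omega)
      omega
  have main : ∀ m ≤ l, ∏ i ∈ Icc 1 m, Phi k a i t ((a (i + 1) : ℤ) - a i - 1) ((a i : ℤ) - i) =
      tilingProd k t a m (a (m + 1) - (m + 1)) := by
    intro m hm
    induction m with
    | zero => simp [tilingProd, triangleProd]
    | succ m ih =>
      have g1 := hge (m + 1) (by omega) (by omega)
      have g2 := hge (m + 2) (by omega) (by omega)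
      have g3 := ha (a := m + 1) (b := m + 2) ⟨by omega, by omega⟩ ⟨by omega, by omega⟩ (by omega)
      rw [prod_Icc_succ_top (Nat.le_add_left 1 _), ih (by omega), mul_comm,
        ← tilingProd_succ k t a m (a (m + 1) - (m + 1)) (by omega)]
      · have := Phi_mul_tilingProd k t a (m + 1) (a (m + 2) - a (m + 1) - 1)
          (a (m + 1) - (m + 1)) (by
            intro i hi
            rw [mem_Icc] at hi
            refine ⟨le_trans hi.1 (hge i hi.1 (by omega)), ?_⟩
            have := ha.monotoneOn (a := i) (b := m + 1) ⟨hi.1, by omega⟩ ⟨by omega, by omega⟩ hi.2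
            omega)
        rw [show a (m + 2) - a (m + 1) - 1 + (a (m + 1) - (m + 1)) = a (m + 2) - (m + 2) by
          omega] at this
        rw [← this]
        congr 2
        · change ((a (m + 2) : ℤ) - _ - 1) = _
          omega
        · omega
      · intro i hi
        rw [mem_Icc] at hi
        exact ha ⟨hi.1, by omega⟩ ⟨by omega, by omega⟩ (by omega)
  exact main l le_rfl

/-! ### Evaluation of the path determinant -/

/-- Determinants of polynomials of degree less than `n`, evaluated at two families of points. -/
lemma det_eval_mul_det_vandermonde {R : Type*} [CommRing R] {n : ℕ} (P : Fin n → Polynomial R)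
    (hP : ∀ r, (P r).natDegree < n) (u v : Fin n → R) :
    (Matrix.of fun r j => (P r).eval (u j)).det * (Matrix.vandermonde v).det =
      (Matrix.of fun r j => (P r).eval (v j)).det * (Matrix.vandermonde u).det := by
  -- The matrix of values is the coefficient matrix times the transposed Vandermonde matrix.
  have key : ∀ u : Fin n → R, (Matrix.of fun r j => (P r).eval (u j)).det =
      (Matrix.of fun r m : Fin n => (P r).coeff m).det * (Matrix.vandermonde u).det := by
    intro u
    rw [← Matrix.det_transpose (Matrix.vandermonde u), ← Matrix.det_mul]
    congr 1
    ext r j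
    rw [Matrix.of_apply, Matrix.mul_apply, Polynomial.eval_eq_sum_range' (hP r),
      Finset.sum_range]
    rfl
  rw [key u, key v]
  ring

lemma det_vandermonde_eq_prod_range {R : Type*} [CommRing R] (n : ℕ) (f : ℕ → R) :
    (Matrix.vandermonde fun i : Fin n => f i).det =
      ∏ j ∈ range n, ∏ i ∈ range j, (f j - f i) := by
  rw [Matrix.det_vandermonde, Finset.prod_range fun j => ∏ i ∈ range j, (f j - f i),
    Finset.prod_comm' (t' := Finset.univ) (s' := fun j => Finset.Iio j) (by simp)]
  refine prod_congr rfl fun j _ => ?_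
  refine Finset.prod_bij (fun i _ => (i : ℕ)) ?_ ?_ ?_ ?_
  · intro i hi
    simpa using hi
  · intro i _ i' _ h
    exact Fin.ext h
  · intro i hi
    rw [mem_range] at hi
    exact ⟨⟨i, hi.trans j.2⟩, by simpa [Fin.lt_def] using hi, rfl⟩
  · intro i _
    rfl

/-- The binomial coefficient with an integer lower index. -/
def binom (n : ℕ) (z : ℤ) : ℚ := if 0 ≤ z then n.choose z.toNat else 0

lemma binom_natCast (n m : ℕ) : binom n m = n.choose m := by simp [binom]

lemma binom_eq_zero_of_neg (n : ℕ) {z : ℤ} (hz : z < 0) : binom n z = 0 := if_neg (by omega)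

lemma binom_eq_zero_of_lt {n : ℕ} {z : ℤ} (hz : n < z) : binom n z = 0 := by
  rw [binom, if_pos (by omega), Nat.choose_eq_zero_of_lt (by omega), Nat.cast_zero]

lemma binom_succ (n : ℕ) (z : ℤ) : binom (n + 1) z = binom n z + binom n (z - 1) := by
  rcases lt_trichotomy z 0 with hz | rfl | hz
  · rw [binom_eq_zero_of_neg _ hz, binom_eq_zero_of_neg _ hz, binom_eq_zero_of_neg _ (by omega),
      add_zero]
  · simp [binom]
  · obtain ⟨m, rfl⟩ : ∃ m : ℕ, z = (m + 1 : ℕ) := ⟨(z - 1).toNat, by omega⟩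
    rw [show ((m + 1 : ℕ) : ℤ) - 1 = m by simp, binom_natCast, binom_natCast, binom_natCast,
      Nat.choose_succ_succ]
    push_cast
    ring

/-- The number of nonintersecting families of lattice paths, as a determinant: the `j`-th path has
`τ j` steps and climbs from height `j` to height `w j`. -/
def pathDet {l : ℕ} (τ : Fin l → ℕ) (w : Fin l → ℤ) : ℚ :=
  (Matrix.of fun r j : Fin l => binom (τ j) (w j - (r : ℕ))).det

lemma prod_range_sub_eq_descFactorial (s r : ℕ) :
    ∏ m ∈ range r, ((s : ℚ) - m) = s.descFactorial r := by
  induction r with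
  | zero => simp
  | succ r ih =>
    rw [prod_range_succ, ih, Nat.descFactorial_succ]
    rcases le_or_gt r s with h | h
    · push_cast [h]; ring
    · rw [Nat.descFactorial_eq_zero_iff_lt.2 h]; simp

/-- The factors outside the parentheses do not involve `r`, so they can be taken out of the column.
The identity also covers vanishing binomials: the descending product is zero for `s < r`, and for `A
> y + 1 + r` the last product contains the zero factor `m = A - 1 - y`. -/
lemma binom_eq_prod (N s l y A r : ℕ) (hA : A ≤ y + l) (hA1 : 1 ≤ A) (hr : r < l)
    (hN : N + A = s + y + 1) :
    binom N ((s : ℤ) - r) = (N.factorial : ℚ) / (y + l - A).factorial * (s.factorial : ℚ)⁻¹ *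
      ((∏ m ∈ range r, ((s : ℚ) - m)) * ∏ m ∈ Ico (r + 1) l, ((y : ℚ) + 1 - A + m)) := by
  rw [prod_range_sub_eq_descFactorial]
  rcases lt_or_ge s r with hs | hs
  · rw [binom_eq_zero_of_neg _ (by omega), Nat.descFactorial_eq_zero_iff_lt.2 hs]
    simp
  · rcases lt_or_ge (y + 1 + r) A with hy | hy
    · rw [binom_eq_zero_of_lt (by omega), prod_eq_zero (i := A - 1 - y)]
      · simp
      · rw [mem_Ico]; omega
      · have : ((A - 1 - y : ℕ) : ℚ) = A - 1 - y := by
          rw [Nat.cast_sub (by omega), Nat.cast_sub hA1]; simp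
        rw [this]; ring
    · have e : ∏ m ∈ Ico (r + 1) l, ((y : ℚ) + 1 - A + m) =
          ((y + l - A).factorial : ℚ) / (y + 1 + r - A).factorial := by
        rw [← poch_eq_factorial_div, prod_Ico_eq_prod_range,
          show ((y + l - A : ℕ) : ℤ) - (y + 1 + r - A : ℕ) = (l - (r + 1) : ℕ) by omega,
          poch_natCast]
        refine prod_congr rfl fun m _ => ?_
        push_cast [hy]
        ring
      rw [e, show (s : ℤ) - r = (s - r : ℕ) by omega, binom_natCast,
        Nat.cast_choose ℚ (by omega), show N - (s - r) = y + 1 + r - A by omega,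
        ← Nat.factorial_mul_descFactorial hs]
      have h0 : (s.descFactorial r : ℚ) ≠ 0 := by
        rw [Nat.cast_ne_zero, Ne, Nat.descFactorial_eq_zero_iff_lt]; omega
      have h1 : ((s - r).factorial : ℚ) ≠ 0 := by positivity
      have h2 : ((y + l - A).factorial : ℚ) ≠ 0 := by positivity
      have h3 : ((y + 1 + r - A).factorial : ℚ) ≠ 0 := by positivity
      push_cast
      field_simp

/-- Row `r` consists of values of a polynomial of degree at most `r + (l - 1 - r)`, so the
determinant is proportional to the Vandermonde determinant of the `a (j + 1)`. The constant is found
at the points `y + 1 + j`. -/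
lemma det_prod_eq (k t l y : ℕ) (a : ℕ → ℕ) :
    (Matrix.of fun r j : Fin l => (∏ m ∈ range r, ((t : ℚ) + (k + 1) * (a (j + 1) - 1) - m)) *
      ∏ m ∈ Ico ((r : ℕ) + 1) l, ((y : ℚ) + 1 - a (j + 1) + m)).det =
    (∏ j ∈ range l, ∏ i ∈ range j, ((a (j + 1) : ℚ) - a (i + 1))) *
      triangleProd k l ((k + 1) * y + t + 1) := by
  set P : Fin l → Polynomial ℚ := fun r =>
    (∏ m ∈ range r, (Polynomial.C ((k : ℚ) + 1) * Polynomial.X +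
      Polynomial.C ((t : ℚ) - (k + 1) - m))) *
      ∏ m ∈ Ico ((r : ℕ) + 1) l, (Polynomial.C (-1) * Polynomial.X +
        Polynomial.C ((y : ℚ) + 1 + m)) with hPdef
  have hP : ∀ r, (P r).natDegree < l := by
    intro r
    have h1 : (∏ m ∈ range (r : ℕ), (Polynomial.C ((k : ℚ) + 1) * Polynomial.X +
      Polynomial.C ((t : ℚ) - (k + 1) - m))).natDegree ≤ (r : ℕ) := by
      refine (Polynomial.natDegree_prod_le _ _).trans ?_
      refine (sum_le_card_nsmul _ _ 1 fun m _ => Polynomial.natDegree_linear_le).trans ?_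
      simp
    have h2 : (∏ m ∈ Ico ((r : ℕ) + 1) l, (Polynomial.C (-1) * Polynomial.X +
        Polynomial.C ((y : ℚ) + 1 + m))).natDegree ≤ l - (r + 1) := by
      refine (Polynomial.natDegree_prod_le _ _).trans ?_
      refine (sum_le_card_nsmul _ _ 1 fun m _ => Polynomial.natDegree_linear_le).trans ?_
      simp
    have h3 : (P r).natDegree ≤ _ := Polynomial.natDegree_mul_le
    have := r.2
    omega
  have hev : ∀ r z, (P r).eval z = (∏ m ∈ range r, ((t : ℚ) + (k + 1) * (z - 1) - m)) *
      ∏ m ∈ Ico ((r : ℕ) + 1) l, ((y : ℚ) + 1 - z + m) := by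
    intro r z
    simp only [hPdef, Polynomial.eval_mul, Polynomial.eval_prod, Polynomial.eval_add,
      Polynomial.eval_C, Polynomial.eval_X]
    congr 1 <;>
    · refine prod_congr rfl fun m _ => ?_
      ring
  have key := det_eval_mul_det_vandermonde P hP (fun j => (a (j + 1) : ℚ))
    (fun j => (y : ℚ) + 1 + (j : ℕ))
  simp only [hev] at key
  -- For `r < j` the factor with `m = j` is zero. On the diagonal the first product is row `r` of
  -- `triangleProd`, and the second ones multiply to the Vandermonde determinant of the points.
  have tri : (Matrix.of fun r j : Fin l =>
      (∏ m ∈ range r, ((t : ℚ) + (k + 1) * ((y : ℚ) + 1 + (j : ℕ) - 1) - m)) *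
      ∏ m ∈ Ico ((r : ℕ) + 1) l, ((y : ℚ) + 1 - ((y : ℚ) + 1 + (j : ℕ)) + m)).det =
      triangleProd k l ((k + 1) * y + t + 1) *
        (Matrix.vandermonde fun j : Fin l => (y : ℚ) + 1 + (j : ℕ)).det := by
    rw [Matrix.det_of_isLowerTriangular, Matrix.det_vandermonde, triangleProd, Finset.prod_range,
      ← prod_mul_distrib]
    · refine prod_congr rfl fun r _ => ?_
      rw [Matrix.of_apply]
      congr 1
      · refine prod_congr rfl fun m _ => ?_
        ring
      · symm
        refine Finset.prod_bij (fun i _ => (i : ℕ)) ?_ ?_ ?_ ?_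
        · intro i hi
          rw [mem_Ioi, Fin.lt_def] at hi
          exact mem_Ico.2 ⟨hi, i.2⟩
        · intro i _ i' _ h
          exact Fin.ext h
        · intro i hi
          rw [mem_Ico] at hi
          exact ⟨⟨i, hi.2⟩, by rw [mem_Ioi, Fin.lt_def]; exact hi.1, rfl⟩
        · intro i _
          ring
    · intro r j hrj
      have hrj : r < j := hrj
      rw [Matrix.of_apply, prod_eq_zero (s := Ico ((r : ℕ) + 1) l) (i := (j : ℕ)), mul_zero]
      · exact mem_Ico.2 ⟨hrj, j.2⟩
      · ring
  have hv : (Matrix.vandermonde fun j : Fin l => (y : ℚ) + 1 + (j : ℕ)).det ≠ 0 := by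
    rw [Matrix.det_vandermonde_ne_zero_iff]
    intro i j hij
    exact Fin.ext (by simpa using hij)
  rw [tri, mul_right_comm] at key
  rw [mul_right_cancel₀ hv key, mul_comm,
    det_vandermonde_eq_prod_range l fun j => (a (j + 1) : ℚ)]

lemma pathDet_eq_tilingProd (k t l y : ℕ) (a : ℕ → ℕ)
    (ha : ∀ i ∈ Icc 1 l, 1 ≤ a i ∧ a i ≤ y + l) :
    pathDet (fun j : Fin l => y + t + k * (a (j + 1) - 1))
      (fun j : Fin l => ((t + (k + 1) * (a (j + 1) - 1) : ℕ) : ℤ)) = tilingProd k t a l y := by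
  rw [tilingProd, mul_assoc _ _ (triangleProd _ _ _), ← det_prod_eq, ← prod_mul_distrib,
    prod_Icc_one_eq_prod_range, Finset.prod_range, ← Matrix.det_mul_row, pathDet]
  congr 1
  ext r j
  obtain ⟨h1, h2⟩ := ha (j + 1) (mem_Icc.2 ⟨by omega, j.2⟩)
  rw [Matrix.of_apply, Matrix.of_apply, Matrix.of_apply,
    binom_eq_prod _ _ l y (a (j + 1)) r h2 h1 r.2 (by
      obtain ⟨b, hb⟩ := Nat.exists_eq_add_of_le h1
      rw [hb, Nat.add_sub_cancel_left]; ring)]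
  push_cast [h1]
  rfl

/-! ### Lozenges, and counting tilings by the partner of a triangle -/

/-- An up-pointing triangle shares an edge exactly with its three neighbours, all of them pointing
down. -/
lemma card_inter_up_eq_two_iff (i j : ℤ) (q : UnitTriangle) :
    ((UnitTriangle.up i j).vertices ∩ q.vertices).card = 2 ↔
      q = .down i j ∨ q = .down i (j - 1) ∨ q = .down (i - 1) j := by
  constructor
  · intro h
    have h3 : ∀ S : Finset (ℤ × ℤ), S.card = 2 → ∃ u v, u ≠ v ∧ u ∈ S ∧ v ∈ S := by
      intro S hS
      obtain ⟨u, v, huv, rfl⟩ := Finset.card_eq_two.1 hS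
      exact ⟨u, v, huv, by simp, by simp⟩
    cases q with
    | up i' j' =>
      exfalso
      by_cases e : i' = i ∧ j' = j
      · obtain ⟨rfl, rfl⟩ := e
        rw [inter_self] at h
        simp [UnitTriangle.vertices] at h
      · obtain ⟨⟨u1, u2⟩, ⟨v1, v2⟩, huv, hu, hv⟩ := h3 _ h
        simp [UnitTriangle.vertices] at hu hv huv
        omega
    | down i' j' =>
      obtain ⟨⟨u1, u2⟩, ⟨v1, v2⟩, huv, hu, hv⟩ := h3 _ h
      simp [UnitTriangle.vertices] at hu hv huv ⊢
      omega
  · have h4 : ∀ S : Finset (ℤ × ℤ), ∀ u v, u ≠ v → S = {u, v} → S.card = 2 := by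
      intro S u v huv hS
      rw [hS, card_pair huv]
    rintro (rfl | rfl | rfl)
    · refine h4 _ (i + 1, j) (i, j + 1) (by simp) ?_
      ext ⟨u, v⟩
      simp [UnitTriangle.vertices]
    · refine h4 _ (i, j) (i + 1, j) (by simp) ?_
      ext ⟨u, v⟩
      simp [UnitTriangle.vertices]
    · refine h4 _ (i, j) (i, j + 1) (by simp) ?_
      ext ⟨u, v⟩
      simp [UnitTriangle.vertices]

lemma card_inter_down_eq_two_iff (i j : ℤ) (q : UnitTriangle) :
    ((UnitTriangle.down i j).vertices ∩ q.vertices).card = 2 ↔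
      q = .up i j ∨ q = .up i (j + 1) ∨ q = .up (i + 1) j := by
  cases q with
  | up i' j' =>
    rw [inter_comm, card_inter_up_eq_two_iff]
    simp
    omega
  | down i' j' =>
    simp only [reduceCtorEq, or_self, iff_false]
    intro h
    obtain ⟨⟨u1, u2⟩, ⟨v1, v2⟩, huv, hS⟩ := card_eq_two.1 h
    have hu : (u1, u2) ∈ (UnitTriangle.down i j).vertices ∩ (UnitTriangle.down i' j').vertices := by
      rw [hS]; simp
    have hv : (v1, v2) ∈ (UnitTriangle.down i j).vertices ∩ (UnitTriangle.down i' j').vertices := by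
      rw [hS]; simp
    by_cases e : i' = i ∧ j' = j
    · obtain ⟨rfl, rfl⟩ := e
      rw [inter_self] at h
      simp [UnitTriangle.vertices] at h
    · simp [UnitTriangle.vertices] at hu hv huv
      omega

lemma ne_of_card_inter_eq_two {p q : UnitTriangle} (h : (p.vertices ∩ q.vertices).card = 2) :
    p ≠ q := by
  cases p with
  | up i j => rw [card_inter_up_eq_two_iff] at h; rintro rfl; simp at h
  | down i j => rw [card_inter_down_eq_two_iff] at h; rintro rfl; simp at h

lemma IsTiling.insert_lozenge {R : Set UnitTriangle} {T : Finset (Finset UnitTriangle)}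
    {p q : UnitTriangle} (hT : IsTiling (R \ {p, q}) T) (hp : p ∈ R) (hq : q ∈ R)
    (hpq : (p.vertices ∩ q.vertices).card = 2) : IsTiling R (insert {p, q} T) := by
  have hdisj : ∀ L ∈ T, Disjoint {p, q} L := by
    intro L hL
    rw [Finset.disjoint_left]
    intro u hu huL
    exact (hT.subset L hL u huL).2 (by simpa using hu)
  refine ⟨?_, ?_, ?_, ?_⟩
  · intro L hL
    rcases mem_insert.1 hL with rfl | hL
    · exact ⟨p, q, hpq, rfl⟩
    · exact hT.isLozenge L hL
  · intro L hL u hu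
    rcases mem_insert.1 hL with rfl | hL
    · rcases mem_insert.1 hu with rfl | hu
      · exact hp
      · rw [mem_singleton.1 hu]; exact hq
    · exact (hT.subset L hL u hu).1
  · intro L hL L' hL' hne
    rcases mem_insert.1 hL with rfl | hL <;> rcases mem_insert.1 hL' with rfl | hL'
    · exact absurd rfl hne
    · exact hdisj _ hL'
    · exact (hdisj _ hL).symm
    · exact hT.disjoint L hL L' hL' hne
  · intro u hu
    by_cases h : u ∈ ({p, q} : Set UnitTriangle)
    · exact ⟨{p, q}, mem_insert_self _ _, by simpa using h⟩
    · obtain ⟨L, hL, huL⟩ := hT.cover u ⟨hu, h⟩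
      exact ⟨L, mem_insert_of_mem hL, huL⟩

lemma IsTiling.erase_lozenge {R : Set UnitTriangle} {T : Finset (Finset UnitTriangle)}
    {p q : UnitTriangle} (hT : IsTiling R T) (hpq : {p, q} ∈ T) :
    IsTiling (R \ {p, q}) (T.erase {p, q}) := by
  refine ⟨fun L hL => hT.isLozenge L (mem_of_mem_erase hL), ?_, fun L hL L' hL' hne =>
    hT.disjoint L (mem_of_mem_erase hL) L' (mem_of_mem_erase hL') hne, ?_⟩
  · intro L hL u hu
    refine ⟨hT.subset L (mem_of_mem_erase hL) u hu, fun h => ?_⟩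
    exact Finset.disjoint_left.1 (hT.disjoint L (mem_of_mem_erase hL) _ hpq (ne_of_mem_erase hL)) hu
      (by simpa using h)
  · rintro u ⟨hu, hu'⟩
    obtain ⟨L, hL, huL⟩ := hT.cover u hu
    refine ⟨L, mem_erase.2 ⟨?_, hL⟩, huL⟩
    rintro rfl
    exact hu' (by simpa using huL)

lemma IsTiling.exists_partner {R : Set UnitTriangle} {T : Finset (Finset UnitTriangle)}
    {p : UnitTriangle} (hT : IsTiling R T) (hp : p ∈ R) :
    ∃ q ∈ R, (p.vertices ∩ q.vertices).card = 2 ∧ {p, q} ∈ T := by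
  obtain ⟨L, hL, hpL⟩ := hT.cover p hp
  obtain ⟨u, v, huv, rfl⟩ := hT.isLozenge L hL
  rcases mem_insert.1 hpL with rfl | h
  · exact ⟨v, hT.subset _ hL v (by simp), huv, hL⟩
  · rw [mem_singleton] at h
    subst h
    exact ⟨u, hT.subset _ hL u (by simp), by rwa [inter_comm], by rwa [pair_comm]⟩

lemma finite_tilings {R : Set UnitTriangle} (hR : R.Finite) :
    Finite {T : Finset (Finset UnitTriangle) // IsTiling R T} := by
  refine Set.Finite.to_subtype (Set.Finite.subset
    (hR.toFinset.powerset.powerset.finite_toSet) fun T hT => ?_)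
  simp only [mem_coe, mem_powerset]
  intro L hL
  rw [mem_powerset]
  intro p hp
  exact hR.mem_toFinset.2 (hT.subset L hL p hp)

/-- Counting tilings according to the partner of a given triangle. -/
lemma tilingCount_eq_sum {R : Set UnitTriangle} (hR : R.Finite) {p : UnitTriangle} (hp : p ∈ R)
    (Q : Finset UnitTriangle) (hQ : ∀ q, q ∈ Q ↔ q ∈ R ∧ (p.vertices ∩ q.vertices).card = 2) :
    tilingCount R = ∑ q ∈ Q, tilingCount (R \ {p, q}) := by
  -- `Nat.card` is zero on infinite types, so splitting the count as a sum over `Q` requires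
  -- finiteness.
  have hfin : ∀ q : Q, Finite {T : Finset (Finset UnitTriangle) // IsTiling (R \ {p, q.1}) T} :=
    fun q => finite_tilings hR.sdiff
  have hnot : ∀ {q : UnitTriangle} {T : Finset (Finset UnitTriangle)} {q' : UnitTriangle},
      IsTiling (R \ {p, q}) T → {p, q'} ∉ T := by
    intro q T q' hT hmem
    exact (hT.subset _ hmem p (by simp)).2 (by simp)
  let g : (Σ q : Q, {T : Finset (Finset UnitTriangle) // IsTiling (R \ {p, q.1}) T}) →
      {T : Finset (Finset UnitTriangle) // IsTiling R T} := fun s =>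
    ⟨insert {p, s.1.1} s.2.1,
      s.2.2.insert_lozenge hp ((hQ _).1 s.1.2).1 ((hQ _).1 s.1.2).2⟩
  have hg : Function.Bijective g := by
    constructor
    · rintro ⟨⟨q, hq⟩, ⟨T, hT⟩⟩ ⟨⟨q', hq'⟩, ⟨T', hT'⟩⟩ h
      have h : insert {p, q} T = insert {p, q'} T' := congrArg Subtype.val h
      have hqq : q = q' := by
        have : {p, q} ∈ insert {p, q'} T' := by rw [← h]; exact mem_insert_self _ _
        rcases mem_insert.1 this with e | e
        · have h1 : q ∈ ({p, q'} : Finset UnitTriangle) := by rw [← e]; simp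
          rcases mem_insert.1 h1 with h1 | h1
          · exact absurd h1.symm (ne_of_card_inter_eq_two ((hQ _).1 hq).2)
          · exact mem_singleton.1 h1
        · exact absurd e (hnot hT')
      subst hqq
      have : T = T' := by
        rw [← erase_insert (hnot hT (q' := q)), h, erase_insert (hnot hT')]
      subst this
      rfl
    · rintro ⟨T, hT⟩
      obtain ⟨q, hq, hpq, hmem⟩ := hT.exists_partner hp
      exact ⟨⟨⟨q, (hQ q).2 ⟨hq, hpq⟩⟩, ⟨T.erase {p, q}, hT.erase_lozenge hmem⟩⟩,
        Subtype.ext (insert_erase hmem)⟩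
  rw [tilingCount, ← Nat.card_eq_of_bijective g hg, Nat.card_sigma,
    ← Finset.sum_coe_sort Q fun q => tilingCount (R \ {p, q})]
  rfl

lemma tilingCount_empty : tilingCount ∅ = 1 := by
  have : IsTiling ∅ ∅ := ⟨by simp, by simp, by simp, by simp⟩
  rw [tilingCount, Nat.card_eq_one_iff_unique]
  refine ⟨⟨fun T T' => ?_⟩, ⟨⟨∅, this⟩⟩⟩
  have h : ∀ T : {T : Finset (Finset UnitTriangle) // IsTiling ∅ T}, T.1 = ∅ := by
    intro T
    refine eq_empty_of_forall_notMem fun L hL => ?_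
    obtain ⟨p, q, -, rfl⟩ := T.2.isLozenge L hL
    exact T.2.subset _ hL p (by simp)
  exact Subtype.ext ((h T).trans (h T').symm)

/-! ### Cutting a region along a lattice line -/

/-- The part of the region `R` to the right of the line `i`, together with the up-pointing
triangles of strip `i` at the heights `S` and the down-pointing ones at the heights `B`. -/
def cut (R : Set UnitTriangle) (i : ℤ) (S B : Set ℤ) : Set UnitTriangle
  | .up i' j => (i < i' ∧ UnitTriangle.up i' j ∈ R) ∨ (i' = i ∧ j ∈ S)
  | .down i' j => (i < i' ∧ UnitTriangle.down i' j ∈ R) ∨ (i' = i ∧ j ∈ B)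

lemma up_mem_cut {R : Set UnitTriangle} {i : ℤ} {S B : Set ℤ} {i' j : ℤ} :
    UnitTriangle.up i' j ∈ cut R i S B ↔
      (i < i' ∧ UnitTriangle.up i' j ∈ R) ∨ (i' = i ∧ j ∈ S) := Iff.rfl

lemma down_mem_cut {R : Set UnitTriangle} {i : ℤ} {S B : Set ℤ} {i' j : ℤ} :
    UnitTriangle.down i' j ∈ cut R i S B ↔
      (i < i' ∧ UnitTriangle.down i' j ∈ R) ∨ (i' = i ∧ j ∈ B) := Iff.rfl

lemma finite_cut {R : Set UnitTriangle} (hR : R.Finite) (i : ℤ) {S B : Set ℤ} (hS : S.Finite)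
    (hB : B.Finite) : (cut R i S B).Finite := by
  refine Set.Finite.subset ((hR.union (hS.image (UnitTriangle.up i))).union
    (hB.image (UnitTriangle.down i))) ?_
  rintro (⟨i', j⟩ | ⟨i', j⟩) h
  · rcases up_mem_cut.1 h with h | ⟨rfl, h'⟩
    · exact Or.inl (Or.inl h.2)
    · exact Or.inl (Or.inr ⟨j, h', rfl⟩)
  · rcases down_mem_cut.1 h with h | ⟨rfl, h'⟩
    · exact Or.inl (Or.inl h.2)
    · exact Or.inr ⟨j, h', rfl⟩

/-- The path ending at the left edge of an up-pointing triangle on the left boundary comes either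
from the east or from the southeast. -/
lemma tilingCount_cut_eq_add {R : Set UnitTriangle} (hR : R.Finite) (i : ℤ) {S B : Set ℤ}
    (hS : S.Finite) (hB : B.Finite) {j : ℤ} (hj : j ∈ S) [Decidable (j ∈ B)] [Decidable (j - 1 ∈ B)] :
    tilingCount (cut R i S B) =
      (if j ∈ B then tilingCount (cut R i (S \ {j}) (B \ {j})) else 0) +
      (if j - 1 ∈ B then tilingCount (cut R i (S \ {j}) (B \ {j - 1})) else 0) := by
  have hdel : ∀ z, cut R i S B \ {.up i j, .down i z} = cut R i (S \ {j}) (B \ {z}) := by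
    intro z
    ext (⟨i', j'⟩ | ⟨i', j'⟩)
    · simp only [Set.mem_sdiff, up_mem_cut, Set.mem_insert_iff, Set.mem_singleton_iff,
        UnitTriangle.up.injEq, reduceCtorEq, or_false]
      grind
    · simp only [Set.mem_sdiff, down_mem_cut, Set.mem_insert_iff, Set.mem_singleton_iff,
        UnitTriangle.down.injEq, reduceCtorEq, false_or]
      grind
  classical
  rw [tilingCount_eq_sum (finite_cut hR i hS hB) (p := .up i j) (up_mem_cut.2 (Or.inr ⟨rfl, hj⟩))
    ((({j, j - 1} : Finset ℤ).filter (· ∈ B)).image (UnitTriangle.down i)), sum_image,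
    sum_filter, sum_pair (by omega), hdel, hdel]
  · congr
  · intro z _ z' _ h
    simpa using h
  · rintro (⟨i', j'⟩ | ⟨i', j'⟩)
    · simp [card_inter_up_eq_two_iff]
    · rw [card_inter_up_eq_two_iff]
      simp only [mem_image, mem_filter, mem_insert, mem_singleton, UnitTriangle.down.injEq,
        down_mem_cut]
      constructor
      · rintro ⟨z, ⟨hz, hzB⟩, rfl, rfl⟩
        exact ⟨Or.inr ⟨rfl, hzB⟩, by tauto⟩
      · rintro ⟨h1, h2⟩
        refine ⟨j', ⟨?_, ?_⟩, ?_, rfl⟩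
        · rcases h2 with h2 | h2 | h2
          · exact Or.inl h2.2
          · exact Or.inr h2.2
          · omega
        · rcases h1 with h1 | h1
          · omega
          · exact h1.2
        · omega

/-- If no path reaches the line `i`, then every triangle of strip `i` lies in a lozenge crossing the
line `i + 1`. -/
lemma tilingCount_cut_empty {R : Set UnitTriangle} (hR : R.Finite) (i : ℤ) {B : Set ℤ}
    (hB : B.Finite) (hBR : ∀ j ∈ B, UnitTriangle.up (i + 1) j ∈ R) :
    tilingCount (cut R i ∅ B) = tilingCount (cut R (i + 1)
      {j | UnitTriangle.up (i + 1) j ∈ R ∧ j ∉ B} {j | UnitTriangle.down (i + 1) j ∈ R}) := by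
  -- The set `C` records the heights already matched across the line `i + 1`. As strip `i` has no
  -- up-pointing triangles left, the partner of `down i b` must be `up (i + 1) b`.
  have key : ∀ B : Finset ℤ, ∀ C : Set ℤ, (∀ j ∈ B, UnitTriangle.up (i + 1) j ∈ R ∧ j ∉ C) →
      tilingCount (cut R i ∅ (B : Set ℤ) \ UnitTriangle.up (i + 1) '' C) =
        tilingCount (cut R i ∅ ∅ \ UnitTriangle.up (i + 1) '' (C ∪ B)) := by
    intro B
    induction B using Finset.induction_on with
    | empty => intro C _; simp
    | insert b B hb ih =>
      intro C hC
      obtain ⟨hbR, hbC⟩ := hC b (mem_insert_self _ _)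
      rw [tilingCount_eq_sum (p := .down i b) (Q := {.up (i + 1) b})
        (Set.Finite.sdiff (finite_cut hR i Set.finite_empty (Finset.finite_toSet _)))
        ⟨down_mem_cut.2 (Or.inr ⟨rfl, by simp⟩), by simp⟩, sum_singleton]
      · have e : (cut R i ∅ ((insert b B : Finset ℤ) : Set ℤ) \ UnitTriangle.up (i + 1) '' C) \
            {.down i b, .up (i + 1) b} =
            cut R i ∅ (B : Set ℤ) \ UnitTriangle.up (i + 1) '' (C ∪ {b}) := by
          ext (⟨i', j'⟩ | ⟨i', j'⟩)
          · simp [up_mem_cut]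
            grind
          · simp [down_mem_cut]
            grind
        rw [e, ih]
        · congr 3
          rw [coe_insert, Set.union_assoc, Set.singleton_union]
        · intro j hj
          refine ⟨(hC j (mem_insert_of_mem hj)).1, ?_⟩
          rintro (h | h)
          · exact (hC j (mem_insert_of_mem hj)).2 h
          · rw [Set.mem_singleton_iff] at h
            exact hb (h ▸ hj)
      · rintro (⟨i', j'⟩ | ⟨i', j'⟩)
        · rw [card_inter_down_eq_two_iff]
          simp [up_mem_cut]
          grind
        · simp [card_inter_down_eq_two_iff]
  have h0 := key hB.toFinset ∅ (fun j hj => ⟨hBR j (hB.mem_toFinset.1 hj), by simp⟩)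
  rw [hB.coe_toFinset, Set.image_empty, Set.sdiff_empty, Set.empty_union] at h0
  rw [h0]
  congr 1
  ext (⟨i', j'⟩ | ⟨i', j'⟩)
  · simp [up_mem_cut]
    grind
  · simp [down_mem_cut]
    grind

/-! ### The path determinant and its recursion -/

/-- Pascal's rule in column `p` and linearity of the determinant in that column: the last step of
the `p`-th path either kept its height or raised it by 1. -/
lemma pathDet_eq_add {l : ℕ} (τ : Fin l → ℕ) (w : Fin l → ℤ) (p : Fin l) (n : ℕ)
    (hp : τ p = n + 1) :
    pathDet τ w = pathDet (Function.update τ p n) w +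
      pathDet (Function.update τ p n) (Function.update w p (w p - 1)) := by
  have e : ∀ (σ : Fin l → ℕ) (v : Fin l → ℤ), (∀ j, j ≠ p → σ j = τ j ∧ v j = w j) →
      pathDet σ v = ((Matrix.of fun r j : Fin l => binom (τ j) (w j - (r : ℕ))).updateCol p
        fun r => binom (σ p) (v p - (r : ℕ))).det := by
    intro σ v h
    rw [pathDet]
    congr 1
    ext r j
    by_cases hj : j = p
    · subst hj; simp
    · simp [Matrix.updateCol_ne hj, h j hj]
  rw [e τ w (by simp), e _ w (by simp +contextual), e _ _ (by simp +contextual),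
    ← Matrix.det_updateCol_add]
  congr 2
  ext r
  simp only [hp, binom_succ, Function.update_self, Pi.add_apply]
  congr 2
  ring

lemma pathDet_eq_zero_of_eq {l : ℕ} {τ : Fin l → ℕ} {w : Fin l → ℤ} {i j : Fin l} (hij : i ≠ j)
    (hτ : τ i = τ j) (hw : w i = w j) : pathDet τ w = 0 :=
  Matrix.det_zero_of_column_eq hij fun r => by simp [hτ, hw]

lemma pathDet_eq_zero_of_neg {l : ℕ} {τ : Fin l → ℕ} {w : Fin l → ℤ} {j : Fin l} (hw : w j < 0) :
    pathDet τ w = 0 :=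
  Matrix.det_eq_zero_of_column_eq_zero j fun r => binom_eq_zero_of_neg _ (by omega)

lemma pathDet_eq_zero_of_lt {l : ℕ} {τ : Fin l → ℕ} {w : Fin l → ℤ} {j : Fin l}
    (hw : (τ j : ℤ) + l ≤ w j) : pathDet τ w = 0 :=
  Matrix.det_eq_zero_of_column_eq_zero j fun r => binom_eq_zero_of_lt (by have := r.2; omega)

lemma pathDet_zero_val (l : ℕ) : pathDet (fun _ : Fin l => 0) (fun j => ((j : ℕ) : ℤ)) = 1 := by
  rw [pathDet, ← Matrix.det_one (n := Fin l)]
  congr 1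
  ext r j
  rw [Matrix.of_apply]
  rcases lt_trichotomy r j with h | rfl | h
  · rw [Matrix.one_apply_ne h.ne, binom_eq_zero_of_lt (by simpa using h)]
  · simp [binom]
  · rw [Matrix.one_apply_ne h.ne', binom_eq_zero_of_neg _ (by simpa using h)]

/-! ### Path regions: the tiling count as a determinant -/

/-- A region in which `l` paths start at the lowest `l` edges of the line `X` and the `m`-th path
ends, after `N m` steps to the left, at height `s m` of the left boundary. -/
structure IsPathRegion (R : Set UnitTriangle) (X : ℤ) (l : ℕ) (N : Fin l → ℕ) (s : Fin l → ℤ) :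
    Prop where
  finite : R.Finite
  monotone_N : Monotone N
  strictMono_s : StrictMono s
  up_lt : ∀ i j, UnitTriangle.up i j ∈ R → i < X
  down_lt : ∀ i j, UnitTriangle.down i j ∈ R → i < X
  up_of_down : ∀ i j, i + 1 < X → UnitTriangle.down i j ∈ R → UnitTriangle.up (i + 1) j ∈ R
  down_of_up : ∀ i j, UnitTriangle.up (i + 1) j ∈ R →
    UnitTriangle.down i j ∈ R ∨ ∃ m, X - N m = i + 1 ∧ s m = j
  up_end : ∀ m, 0 < N m → UnitTriangle.up (X - N m) (s m) ∈ R
  lt_of_down : ∀ m j, UnitTriangle.down (X - N m - 1) j ∈ R → s m < j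
  down_east : ∀ i j, UnitTriangle.up i j ∈ R → UnitTriangle.down i j ∈ R ∨ X - i - 1 + l ≤ j
  down_southeast : ∀ i j, UnitTriangle.up i j ∈ R → UnitTriangle.down i (j - 1) ∈ R ∨ j - 1 < 0
  start : ∀ j, UnitTriangle.down (X - 1) j ∈ R → 0 ≤ j ∧ j < l
  end_start : ∀ m, N m = 0 → 0 ≤ s m ∧ s m < l

lemma strictMono_eq_val {l : ℕ} {w : Fin l → ℤ} (hw : StrictMono w)
    (h : ∀ j, 0 ≤ w j ∧ w j < l) (j : Fin l) : w j = (j : ℕ) := by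
  have hlow : ∀ m : ℕ, ∀ hm : m < l, (m : ℤ) ≤ w ⟨m, hm⟩ := by
    intro m
    induction m with
    | zero => intro hm; exact (h _).1
    | succ m ih =>
      intro hm
      have h1 := ih (by omega)
      have h2 : w ⟨m, by omega⟩ < w ⟨m + 1, hm⟩ := hw (by simp [Fin.lt_def])
      push_cast
      omega
  have hupp : ∀ m : ℕ, ∀ hm : m < l, w ⟨l - 1 - m, by omega⟩ ≤ l - 1 - m := by
    intro m
    induction m with
    | zero => intro hm; have := (h ⟨l - 1 - 0, by omega⟩).2; push_cast; omega
    | succ m ih =>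
      intro hm
      have h1 := ih (by omega)
      have h2 : w ⟨l - 1 - (m + 1), by omega⟩ < w ⟨l - 1 - m, by omega⟩ :=
        hw (by simp only [Fin.lt_def]; omega)
      push_cast
      omega
  have h1 := hlow j j.2
  have h2 := hupp (l - 1 - j) (by omega)
  have e : (⟨l - 1 - (l - 1 - j), by omega⟩ : Fin l) = j := Fin.ext (by simp; omega)
  rw [e] at h2
  rw [Fin.eta] at h1
  omega

variable {R : Set UnitTriangle} {X : ℤ} {l : ℕ} {N : Fin l → ℕ} {s : Fin l → ℤ}

lemma IsPathRegion.finite_down (hR : IsPathRegion R X l N s) (i : ℤ) (P : ℤ → Prop) :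
    {z | UnitTriangle.down i z ∈ R ∧ P z}.Finite := by
  refine Set.Finite.subset (hR.finite.preimage (f := UnitTriangle.down i) ?_) fun z hz => hz.1
  intro z _ z' _ h
  simpa using h

/-- The paths have been followed back to time `n`; those with more than `n` steps cross the line
`X - n` at the heights `w`. -/
def IsCount (R : Set UnitTriangle) (X : ℤ) {l : ℕ} (N : Fin l → ℕ) (s : Fin l → ℤ) (n : ℕ) :
    Prop :=
  ∀ w : Fin l → ℤ, (∀ j, N j ≤ n → w j = s j) →
    (∀ j, n < N j → UnitTriangle.down (X - n - 1) (w j) ∈ R) →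
    StrictMonoOn w {j | n ≤ N j} →
    (tilingCount (cut R (X - n - 1) ∅
      {z | UnitTriangle.down (X - n - 1) z ∈ R ∧ ∀ j, n < N j → z ≠ w j}) : ℚ) =
      pathDet (fun j => min n (N j)) w

/-- Strictly increasing heights in `[0, l)` force `w j = j`, so no triangle is left to cover and the
matrix is the identity. -/
lemma IsPathRegion.isCount_zero (hR : IsPathRegion R X l N s) : IsCount R X N s 0 := by
  intro w hw hdown hmono
  simp only [Nat.cast_zero, sub_zero] at hdown ⊢
  have hmono' : StrictMono w := fun i j hij => hmono (by simp) (by simp) hij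
  have hval := strictMono_eq_val hmono' fun j => by
    rcases Nat.eq_zero_or_pos (N j) with h | h
    · rw [hw j h.le]; exact hR.end_start j h
    · exact hR.start _ (hdown j h)
  have hempty : cut R (X - 1) ∅ {z | UnitTriangle.down (X - 1) z ∈ R ∧ ∀ j, 0 < N j → z ≠ w j} =
      ∅ := by
    refine Set.eq_empty_of_forall_notMem ?_
    rintro (⟨i, z⟩ | ⟨i, z⟩) h
    · rcases up_mem_cut.1 h with h | h
      · have := hR.up_lt _ _ h.2; omega
      · exact h.2
    · rcases down_mem_cut.1 h with h | ⟨-, h, h'⟩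
      · have := hR.down_lt _ _ h.2; omega
      · obtain ⟨h0, h1⟩ := hR.start z h
        have hz : w ⟨z.toNat, by omega⟩ = z := by rw [hval]; simp [h0]
        rcases Nat.eq_zero_or_pos (N ⟨z.toNat, by omega⟩) with h2 | h2
        -- A path of length zero ends on the line `X` itself, and the region has no down-pointing
        -- triangle at its height in the strip to the left.
        · have h3 := hR.lt_of_down ⟨z.toNat, by omega⟩ z (by rw [h2]; simpa using h)
          rw [← hw _ h2.le, hz] at h3
          omega
        · exact h' _ h2 hz.symm
  rw [hempty, tilingCount_empty, funext hval]
  simp [pathDet_zero_val]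

/-- The situation within one strip: the paths with index at least `p` still have to be followed
through the strip between the lines `X - n - 1` and `X - n`. -/
lemma IsPathRegion.tilingCount_cut_strip (hR : IsPathRegion R X l N s) {n : ℕ}
    (hn : IsCount R X N s n) (p : ℕ) (hp : p ≤ l) (v : Fin l → ℤ) (hv : ∀ j, N j ≤ n → v j = s j)
    (hdown : ∀ j : Fin l, (j : ℕ) < p → n < N j → UnitTriangle.down (X - n - 1) (v j) ∈ R)
    (hup : ∀ j : Fin l, p ≤ (j : ℕ) → n < N j → UnitTriangle.up (X - n - 1) (v j) ∈ R)
    (hmono : StrictMonoOn v {j | n < N j}) :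
    (tilingCount (cut R (X - n - 1) {z | ∃ j : Fin l, p ≤ (j : ℕ) ∧ n < N j ∧ z = v j}
      {z | UnitTriangle.down (X - n - 1) z ∈ R ∧ ∀ j : Fin l, (j : ℕ) < p → n < N j → z ≠ v j})
      : ℚ) = pathDet (fun j : Fin l => if (j : ℕ) < p then min n (N j) else min (n + 1) (N j)) v := by
  induction hp using Nat.decreasingInduction generalizing v with
  | self =>
    have h1 : {z | ∃ j : Fin l, l ≤ (j : ℕ) ∧ n < N j ∧ z = v j} = ∅ := by
      refine Set.eq_empty_of_forall_notMem ?_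
      rintro z ⟨j, hj, -⟩
      have := j.2
      omega
    simp only [Fin.is_lt, forall_const, if_true] at hdown ⊢
    rw [h1]
    refine hn v hv hdown ?_
    intro i hi j hj hij
    rcases Nat.lt_or_ge n (N i) with h | h
    · exact hmono h (lt_of_lt_of_le h (hR.monotone_N hij.le)) hij
    · rw [hv i h]
      rcases Nat.lt_or_ge n (N j) with h' | h'
      · refine hR.lt_of_down i _ ?_
        rw [le_antisymm h hi]
        exact hdown j h'
      · rw [hv j h']
        exact hR.strictMono_s hij
  | of_succ p hpl ih =>
    set P : Fin l := ⟨p, hpl⟩ with hP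
    have hlt : ∀ j : Fin l, (j : ℕ) < p + 1 ↔ (j : ℕ) < p ∨ j = P := by
      intro j
      rw [Fin.ext_iff, hP]
      simp only
      omega
    have hle : ∀ j : Fin l, p ≤ (j : ℕ) ↔ p + 1 ≤ (j : ℕ) ∨ j = P := by
      intro j
      rw [Fin.ext_iff, hP]
      simp only
      omega
    rcases Nat.lt_or_ge n (N P) with hNP | hNP
    · set i := X - (n : ℤ) - 1 with hi
      set S : Set ℤ := {z | ∃ j : Fin l, p ≤ (j : ℕ) ∧ n < N j ∧ z = v j} with hS
      set B : Set ℤ := {z | UnitTriangle.down i z ∈ R ∧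
        ∀ j : Fin l, (j : ℕ) < p → n < N j → z ≠ v j} with hB
      have hSfin : S.Finite := by
        refine Set.Finite.subset (Set.finite_range v) ?_
        rintro z ⟨j, -, -, rfl⟩
        exact ⟨j, rfl⟩
      have hBfin : B.Finite := hR.finite_down _ _
      have hPS : v P ∈ S := ⟨P, le_rfl, hNP, rfl⟩
      have hPup : UnitTriangle.up i (v P) ∈ R := hup P le_rfl hNP
      have hinj : ∀ j : Fin l, n < N j → j ≠ P → v j ≠ v P := fun j hj hjP h =>
        hjP (hmono.injOn hj hNP h)
      classical
      -- The alternatives for path `P` in this strip: it enters at the height `v P` at which it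
      -- leaves, or one lower.
      have branch : ∀ z, z = v P ∨ z = v P - 1 →
          ((if z ∈ B then tilingCount (cut R i (S \ {v P}) (B \ {z})) else 0 : ℕ) : ℚ) =
          pathDet (fun j : Fin l => if (j : ℕ) < p + 1 then min n (N j) else min (n + 1) (N j))
            (Function.update v P z) := by
        intro z hz
        by_cases hzB : z ∈ B
        · rw [if_pos hzB]
          -- Order survives because lower paths were treated first: `z ≥ v P - 1` is at least every
          -- lower height, and `z ∈ B` excludes equality.
          have hm : StrictMonoOn (Function.update v P z) {j | n < N j} := by
            intro j hj j' hj' hjj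
            by_cases h1 : j = P
            · subst h1
              have := hmono hj hj' hjj
              rw [Function.update_self, Function.update_of_ne hjj.ne']
              omega
            · rw [Function.update_of_ne h1]
              by_cases h2 : j' = P
              · subst h2
                have h3 := hmono hj hj' hjj
                have h4 := hzB.2 j hjj hj
                rw [Function.update_self]
                omega
              · rw [Function.update_of_ne h2]
                exact hmono hj hj' hjj
          rw [← ih (Function.update v P z) ?_ ?_ ?_ hm]
          · congr 3
            · ext u
              constructor
              · rintro ⟨⟨j, hj, hjN, rfl⟩, hne⟩
                have hjP : j ≠ P := by rintro rfl; exact hne rfl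
                refine ⟨j, ((hle j).1 hj).resolve_right hjP, hjN, ?_⟩
                rw [Function.update_of_ne hjP]
              · rintro ⟨j, hj, hjN, rfl⟩
                have hjP : j ≠ P := by
                  rintro rfl
                  exact absurd hj (by simp [hP])
                rw [Function.update_of_ne hjP]
                exact ⟨⟨j, by omega, hjN, rfl⟩, hinj j hjN hjP⟩
            · ext u
              constructor
              · rintro ⟨⟨h1, h2⟩, h3⟩
                refine ⟨h1, fun j hj hjN => ?_⟩
                by_cases hjP : j = P
                · rw [hjP, Function.update_self]; exact h3
                · rw [Function.update_of_ne hjP]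
                  exact h2 j (((hlt j).1 hj).resolve_right hjP) hjN
              · rintro ⟨h1, h2⟩
                refine ⟨⟨h1, fun j hj hjN => ?_⟩, ?_⟩
                · have hjP : j ≠ P := by
                    rintro rfl
                    exact absurd hj (by simp [hP])
                  have := h2 j (by omega) hjN
                  rwa [Function.update_of_ne hjP] at this
                · have := h2 P (by simp [hP]) hNP
                  rwa [Function.update_self] at this
          · intro j hj
            have hjP : j ≠ P := by rintro rfl; omega
            rw [Function.update_of_ne hjP]
            exact hv j hj
          · intro j hj hjN
            by_cases hjP : j = P
            · rw [hjP, Function.update_self]; exact hzB.1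
            · rw [Function.update_of_ne hjP]
              exact hdown j (((hlt j).1 hj).resolve_right hjP) hjN
          · intro j hj hjN
            have hjP : j ≠ P := by
              rintro rfl
              exact absurd hj (by simp [hP])
            rw [Function.update_of_ne hjP]
            exact hup j (by omega) hjN
        -- An unavailable height is either taken by a lower path, giving equal columns, or outside
        -- the region, where it is too high or negative and gives a zero column.
        · rw [if_neg hzB, Nat.cast_zero]
          symm
          by_cases hzR : UnitTriangle.down i z ∈ R
          · have : ∃ j : Fin l, (j : ℕ) < p ∧ n < N j ∧ z = v j := by
              by_contra hcon
              push Not at hcon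
              exact hzB ⟨hzR, hcon⟩
            obtain ⟨j, hj, hjN, hjz⟩ := this
            have hjP : j ≠ P := by
              rintro rfl
              exact absurd hj (by simp [hP])
            refine pathDet_eq_zero_of_eq hjP ?_ ?_
            · rw [if_pos (by omega), if_pos (by simp [hP]), min_eq_left hjN.le, min_eq_left hNP.le]
            · rw [Function.update_self, Function.update_of_ne hjP, hjz]
          · rcases hz with rfl | rfl
            · refine pathDet_eq_zero_of_lt (j := P) ?_
              have := (hR.down_east _ _ hPup).resolve_left hzR
              rw [if_pos (by simp [hP]), min_eq_left hNP.le, Function.update_self]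
              omega
            · refine pathDet_eq_zero_of_neg (j := P) ?_
              have := (hR.down_southeast _ _ hPup).resolve_left hzR
              rw [Function.update_self]
              exact this
      rw [tilingCount_cut_eq_add hR.finite i hSfin hBfin hPS, Nat.cast_add, branch _ (Or.inl rfl),
        branch _ (Or.inr rfl), Function.update_eq_self,
        pathDet_eq_add (fun j : Fin l => if (j : ℕ) < p then min n (N j) else min (n + 1) (N j))
          v P n]
      · have e : (fun j : Fin l => if (j : ℕ) < p + 1 then min n (N j) else min (n + 1) (N j)) =
            Function.update (fun j : Fin l => if (j : ℕ) < p then min n (N j) else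
              min (n + 1) (N j)) P n := by
          ext j
          by_cases hjP : j = P
          · rw [hjP, Function.update_self, if_pos (by simp [hP]), min_eq_left hNP.le]
          · rw [Function.update_of_ne hjP]
            simp only [hlt, hjP, or_false]
        rw [e]
      · rw [if_neg (by simp [hP]), min_eq_left (by omega)]
    · have hne : ∀ j : Fin l, n < N j → j ≠ P := by
        rintro j hj rfl
        omega
      have ih' := ih v hv
        (fun j hj hjN => hdown j (((hlt j).1 hj).resolve_right (hne j hjN)) hjN)
        (fun j hj hjN => hup j (by omega) hjN) hmono
      convert ih' using 2
      · congr 2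
        · ext z
          refine exists_congr fun j => ?_
          constructor
          · rintro ⟨h1, h2, h3⟩
            exact ⟨((hle j).1 h1).resolve_right (hne j h2), h2, h3⟩
          · rintro ⟨h1, h2, h3⟩
            exact ⟨by omega, h2, h3⟩
        · ext z
          refine and_congr_right fun _ => forall_congr' fun j => ?_
          constructor
          · intro h h1 h2
            exact h (((hlt j).1 h1).resolve_right (hne j h2)) h2
          · intro h h1 h2
            exact h (by omega) h2
      · ext j
        by_cases hjP : j = P
        · subst hjP
          rw [if_neg (by simp [hP]), if_pos (by simp [hP])]
          omega
        · simp only [hlt, hjP, or_false]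

/-- Forced lozenges across the line `X - n - 1` clear the strip to its left; the up-pointing
triangles then left uncovered to its right are exactly those at the heights `w j` with `n < N j`.
Following all paths through this strip reduces to time `n`. -/
lemma IsPathRegion.isCount_succ (hR : IsPathRegion R X l N s) {n : ℕ} (hn : IsCount R X N s n) :
    IsCount R X N s (n + 1) := by
  intro w hw hdown hmono
  have e1 : X - ((n + 1 : ℕ) : ℤ) - 1 + 1 = X - n - 1 := by push_cast; ring
  have hup : ∀ j, n < N j → UnitTriangle.up (X - n - 1) (w j) ∈ R := by
    intro j hj
    rcases Nat.lt_or_ge (n + 1) (N j) with h | h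
    · have := hR.up_of_down _ _ (by omega) (hdown j h)
      rwa [e1] at this
    · have := hR.up_end j (by omega)
      rw [hw j h]
      rwa [show X - (N j : ℤ) = X - n - 1 by omega] at this
  rw [tilingCount_cut_empty hR.finite _ (hR.finite_down _ _)
    fun z hz => hR.up_of_down _ _ (by omega) hz.1, e1]
  have key := hR.tilingCount_cut_strip hn 0 (Nat.zero_le _) w (fun j hj => hw j (by omega))
    (fun j hj => absurd hj (by omega)) (fun j _ hj => hup j hj)
    (fun i hi j hj hij => hmono hi hj hij)
  simp only [zero_le, true_and, not_lt_zero, false_imp_iff, implies_true, and_true, if_false]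
    at key
  rw [← key]
  congr 3
  ext z
  constructor
  · rintro ⟨h1, h2⟩
    rw [← e1] at h1
    -- Such a triangle lacks a left neighbour only where a path ends on this line; otherwise its
    -- left neighbour was removed because a path passes there.
    rcases hR.down_of_up _ _ h1 with h | ⟨m, hm, rfl⟩
    · by_contra hcon
      refine h2 ⟨h, fun j hj hz => hcon ⟨j, by omega, hz⟩⟩
    · exact ⟨m, by omega, (hw m (by omega)).symm⟩
  · rintro ⟨j, hj, rfl⟩
    refine ⟨hup j hj, ?_⟩
    rintro ⟨h1, h2⟩
    rcases Nat.lt_or_ge (n + 1) (N j) with h | h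
    · exact h2 j h rfl
    · have := hR.lt_of_down j (w j) (by
        rwa [show X - (N j : ℤ) - 1 = X - ((n + 1 : ℕ) : ℤ) - 1 by push_cast; omega])
      rw [hw j h] at this
      omega

/-- The number of tilings of a path region is the determinant of the path numbers. -/
theorem IsPathRegion.tilingCount_eq_pathDet (hR : IsPathRegion R X l N s) :
    (tilingCount R : ℚ) = pathDet N s := by
  have hcount : ∀ n, IsCount R X N s n := fun n => by
    induction n with
    | zero => exact hR.isCount_zero
    | succ n ih => exact hR.isCount_succ ih
  obtain ⟨b, hb⟩ : ∃ b : ℤ, ∀ i j, (UnitTriangle.up i j ∈ R ∨ UnitTriangle.down i j ∈ R) →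
      b < i := by
    obtain ⟨b, hb⟩ := (hR.finite.image fun p : UnitTriangle =>
      match p with | .up i _ => i | .down i _ => i).bddBelow
    refine ⟨b - 1, fun i j h => ?_⟩
    have : b ≤ i := by
      rcases h with h | h
      · exact hb ⟨_, h, rfl⟩
      · exact hb ⟨_, h, rfl⟩
    omega
  obtain ⟨M, hM⟩ : ∃ M, ∀ j, N j ≤ M := ⟨∑ j, N j, fun j =>
    single_le_sum (f := N) (fun _ _ => Nat.zero_le _) (mem_univ j)⟩
  -- At this time every path is complete and the cut lies to the left of the whole region.
  set n := max M (X - b).toNat with hn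
  have hNn : ∀ j, N j ≤ n := fun j => (hM j).trans (le_max_left _ _)
  have hXb : X - n - 1 ≤ b := by
    have : (X - b).toNat ≤ n := le_max_right _ _
    omega
  have key := hcount n s (fun _ _ => rfl) (fun j hj => absurd (hNn j) (by omega))
    (hR.strictMono_s.strictMonoOn _)
  simp only [min_eq_right (hNn _)] at key
  rw [← key]
  congr 2
  ext (⟨i, j⟩ | ⟨i, j⟩)
  · rw [up_mem_cut]
    constructor
    · intro h
      have := hb i j (Or.inl h)
      exact Or.inl ⟨by omega, h⟩
    · rintro (h | h)
      · exact h.2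
      · exact absurd h.2 (by simp)
  · rw [down_mem_cut]
    constructor
    · intro h
      have := hb i j (Or.inr h)
      exact Or.inl ⟨by omega, h⟩
    · rintro (h | ⟨rfl, h⟩)
      · exact h.2
      · exact h.1

/-! ### The staircase, and the halved hexagon as a path region -/

lemma stepHeight_strictMono (k t : ℕ) : StrictMono (stepHeight k t) := by
  intro m m' h
  have : (m : ℤ) < m' := by exact_mod_cast h
  have h2 : (0 : ℤ) ≤ k := by positivity
  simp only [stepHeight]
  nlinarith

lemma stepsBelow_mono (k t n : ℕ) : Monotone (stepsBelow k t n) := by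
  intro j j' h
  refine card_le_card fun m hm => ?_
  rw [mem_filter] at hm ⊢
  exact ⟨hm.1, hm.2.trans_le h⟩

lemma stepsBelow_stepHeight (k t n : ℕ) {m : ℕ} (hm : m ∈ Icc 1 n) :
    stepsBelow k t n (stepHeight k t m) + 1 = m := by
  rw [mem_Icc] at hm
  have : ((Icc 1 n).filter fun m' => stepHeight k t m' < stepHeight k t m) = Icc 1 (m - 1) := by
    ext m'
    simp only [mem_filter, mem_Icc, (stepHeight_strictMono k t).lt_iff_lt]
    omega
  rw [stepsBelow, this, Nat.card_Icc]
  omega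

lemma stepsBelow_stepHeight_add_one (k t n : ℕ) {m : ℕ} (hm : m ∈ Icc 1 n) :
    stepsBelow k t n (stepHeight k t m + 1) = m := by
  rw [mem_Icc] at hm
  have : ((Icc 1 n).filter fun m' => stepHeight k t m' < stepHeight k t m + 1) = Icc 1 m := by
    ext m'
    simp only [mem_filter, mem_Icc, Int.lt_add_one_iff, (stepHeight_strictMono k t).le_iff_le]
    omega
  rw [stepsBelow, this, Nat.card_Icc]
  omega

lemma stepsBelow_add_one (k t n : ℕ) (j : ℤ) :
    stepsBelow k t n (j + 1) = stepsBelow k t n j ∨ ∃ m ∈ Icc 1 n, stepHeight k t m = j := by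
  by_cases h : ∃ m ∈ Icc 1 n, stepHeight k t m = j
  · exact Or.inr h
  · left
    rw [stepsBelow, stepsBelow]
    congr 1
    refine filter_congr fun m hm => ?_
    have : stepHeight k t m ≠ j := fun e => h ⟨m, hm, e⟩
    omega

lemma stepsBelow_add_one_le (k t n : ℕ) (j : ℤ) :
    stepsBelow k t n (j + 1) ≤ stepsBelow k t n j + 1 := by
  rcases stepsBelow_add_one k t n j with h | ⟨m, hm, rfl⟩
  · omega
  · rw [stepsBelow_stepHeight k t n hm, stepsBelow_stepHeight_add_one k t n hm]

/-- The staircase never goes right, in the coordinate that counts the up-left edges. -/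
lemma sub_stepsBelow_mono (k t n : ℕ) {j j' : ℤ} (h : j ≤ j') :
    j - stepsBelow k t n j ≤ j' - stepsBelow k t n j' := by
  induction j', h using Int.leInduction with
  | base => exact le_rfl
  | succ j' _ ih =>
    have := stepsBelow_add_one_le k t n j'
    omega

lemma stepHeight_add_one_le (k t h l : ℕ) {m : ℕ} (hm : m ∈ Icc 1 (h + l)) :
    stepHeight k t m + 1 ≤ h * (k + 1) + ((l : ℤ) - 1) * k + t + l := by
  rw [mem_Icc] at hm
  have h1 : (m : ℤ) ≤ h + l := by exact_mod_cast hm.2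
  have h2 : (0 : ℤ) ≤ k := by positivity
  rw [stepHeight]
  nlinarith

/-- The side of the hexagon cut off by the staircase imposes no condition. -/
lemma sub_stepsBelow_le (k t h l : ℕ) {j : ℤ}
    (hj : j ≤ h * (k + 1) + ((l : ℤ) - 1) * k + t + l) :
    j - stepsBelow k t (h + l) j ≤ h * (k + 1) + ((l : ℤ) - 1) * k + t := by
  refine (sub_stepsBelow_mono k t (h + l) hj).trans ?_
  have : h + l ≤ stepsBelow k t (h + l) (h * (k + 1) + ((l : ℤ) - 1) * k + t + l) := by
    rcases Nat.eq_zero_or_pos (h + l) with h0 | h0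
    · omega
    · have hm : h + l ∈ Icc 1 (h + l) := mem_Icc.2 ⟨h0, le_rfl⟩
      calc h + l = stepsBelow k t (h + l) (stepHeight k t (h + l) + 1) :=
            (stepsBelow_stepHeight_add_one k t _ hm).symm
        _ ≤ _ := stepsBelow_mono k t _ (stepHeight_add_one_le k t h l hm)
  omega

/-- The two western sides of the hexagon impose nothing new: `0 ≤ i + j` holds because `stepsBelow`
is nonnegative, and the southwest bound is `sub_stepsBelow_le`. -/
lemma mem_points_iff (k x t h l : ℕ) (i j : ℤ) :
    ((i, j) ∈ hexagonPoints (x + h) (h * (k + 1) + ((l : ℤ) - 1) * k + t) l ∧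
      (i, j) ∈ rightOfStaircase k t (h + l)) ↔
      0 ≤ j ∧ j ≤ h * (k + 1) + ((l : ℤ) - 1) * k + t + l ∧ i ≤ x + h ∧ i + j ≤ x + h + l ∧
        stepsBelow k t (h + l) j ≤ i + j := by
  simp only [hexagonPoints, rightOfStaircase, Set.mem_ofPred_eq]
  have := fun H => sub_stepsBelow_le k t h l (j := j) H
  constructor
  · rintro ⟨⟨h1, h2, h3, h4, h5, h6⟩, h7⟩
    exact ⟨h1, h2, h4, h6, by omega⟩
  · rintro ⟨h1, h2, h3, h4, h5⟩
    have := this h2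
    exact ⟨⟨h1, h2, by omega, h3, by omega, h4⟩, by omega⟩

lemma up_mem_halvedHexagon (k x t h l : ℕ) (a : ℕ → ℕ) (i j : ℤ) :
    UnitTriangle.up i j ∈ halvedHexagon k x t h l a ↔
      (0 ≤ j ∧ j + 1 ≤ h * (k + 1) + ((l : ℤ) - 1) * k + t + l ∧ i + 1 ≤ x + h ∧
        i + j + 1 ≤ x + h + l ∧ stepsBelow k t (h + l) j ≤ i + j) ∧
      ∀ m ∈ Icc 1 (h + l), (∀ q ∈ Icc 1 l, m ≠ a q) →
        ¬(i + j + 1 = m ∧ j = stepHeight k t m) := by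
  have h1 := stepsBelow_add_one_le k t (h + l) j
  rw [halvedHexagon, Set.mem_ofPred_eq]
  refine and_congr ?_ (forall₃_congr fun m _ _ => not_congr ?_)
  · simp only [UnitTriangle.vertices, mem_insert, mem_singleton, forall_eq_or_imp, forall_eq,
      mem_points_iff]
    omega
  · rw [dent, UnitTriangle.up.injEq]
    omega

lemma down_mem_halvedHexagon (k x t h l : ℕ) (a : ℕ → ℕ) (i j : ℤ) :
    UnitTriangle.down i j ∈ halvedHexagon k x t h l a ↔
      0 ≤ j ∧ j + 1 ≤ h * (k + 1) + ((l : ℤ) - 1) * k + t + l ∧ i + 1 ≤ x + h ∧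
        i + j + 2 ≤ x + h + l ∧ stepsBelow k t (h + l) (j + 1) ≤ i + j + 1 := by
  have h1 := stepsBelow_mono k t (h + l) (show j ≤ j + 1 by omega)
  rw [halvedHexagon, Set.mem_ofPred_eq]
  have : ∀ m ∈ Icc 1 (h + l), (∀ q ∈ Icc 1 l, m ≠ a q) → UnitTriangle.down i j ≠ dent k t m := by
    intro m _ _
    simp [dent]
  rw [and_iff_left this]
  simp only [UnitTriangle.vertices, mem_insert, mem_singleton, forall_eq_or_imp, forall_eq,
      mem_points_iff]
  omega

lemma finite_halvedHexagon (k x t h l : ℕ) (a : ℕ → ℕ) : (halvedHexagon k x t h l a).Finite := by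
  set c : ℤ := h * (k + 1) + ((l : ℤ) - 1) * k + t + l with hc
  have hbox : (Set.Icc (-c) (x + h : ℤ) ×ˢ Set.Icc (0 : ℤ) c).Finite :=
    (Set.finite_Icc _ _).prod (Set.finite_Icc _ _)
  refine Set.Finite.subset ((hbox.image fun p => UnitTriangle.up p.1 p.2).union
    (hbox.image fun p => UnitTriangle.down p.1 p.2)) ?_
  rintro (⟨i, j⟩ | ⟨i, j⟩) hp
  · rw [up_mem_halvedHexagon] at hp
    refine Or.inl ⟨(i, j), ⟨⟨?_, ?_⟩, ?_, ?_⟩, rfl⟩ <;> simp only <;> omega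
  · rw [down_mem_halvedHexagon] at hp
    refine Or.inr ⟨(i, j), ⟨⟨?_, ?_⟩, ?_, ?_⟩, rfl⟩ <;> simp only <;> omega

/-- Line `X = x + h` carries the southeast side. Step `m` lies on the line `m - 1 - stepHeight k t
m`, whose distance from `X` is the path length `x + h + t + k (m - 1)`. -/
lemma isPathRegion_halvedHexagon (k x t h l : ℕ) (a : ℕ → ℕ)
    (ha : StrictMonoOn a (Set.Icc 1 l)) (ha_mem : ∀ i ∈ Set.Icc 1 l, a i ∈ Set.Icc 1 (h + l)) :
    IsPathRegion (halvedHexagon k x t h l a) (x + h) l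
      (fun j => x + h + t + k * (a (j + 1) - 1))
      (fun j => ((t + (k + 1) * (a (j + 1) - 1) : ℕ) : ℤ)) := by
  have hmem : ∀ j : Fin l, (j : ℕ) + 1 ∈ Set.Icc 1 l := fun j => ⟨by omega, j.2⟩
  have hmemIcc : ∀ j : Fin l, a (j + 1) ∈ Icc 1 (h + l) := fun j => by
    have := ha_mem _ (hmem j)
    exact mem_Icc.2 ⟨this.1, this.2⟩
  have hlt : ∀ i j : Fin l, i < j → a (i + 1) - 1 < a (j + 1) - 1 := by
    intro i j hij
    have h1 := ha (hmem i) (hmem j) (by simpa using hij)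
    have h2 := (mem_Icc.1 (hmemIcc i)).1
    omega
  have hs : ∀ j : Fin l, ((t + (k + 1) * (a (j + 1) - 1) : ℕ) : ℤ) = stepHeight k t (a (j + 1)) := by
    intro j
    have h2 := (mem_Icc.1 (hmemIcc j)).1
    rw [stepHeight]
    push_cast [h2]
    ring
  have hN : ∀ j : Fin l, (x + h : ℤ) - ((x + h + t + k * (a (j + 1) - 1) : ℕ) : ℤ) =
      a (j + 1) - 1 - stepHeight k t (a (j + 1)) := by
    intro j
    have h2 := (mem_Icc.1 (hmemIcc j)).1
    rw [stepHeight]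
    push_cast [h2]
    ring
  refine ⟨finite_halvedHexagon _ _ _ _ _ _, ?_, ?_, ?_, ?_, ?_, ?_, ?_, ?_, ?_, ?_, ?_, ?_⟩
  · intro i j hij
    rcases hij.eq_or_lt with rfl | hij
    · exact le_rfl
    · exact Nat.add_le_add_left (Nat.mul_le_mul_left k (hlt i j hij).le) _
  · intro i j hij
    have := Nat.mul_lt_mul_of_pos_left (hlt i j hij) (Nat.succ_pos k)
    simp only
    exact_mod_cast Nat.add_lt_add_left this t
  · intro i j hij
    rw [up_mem_halvedHexagon] at hij
    omega
  · intro i j hij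
    rw [down_mem_halvedHexagon] at hij
    omega
  · intro i j hi hij
    rw [down_mem_halvedHexagon] at hij
    have := stepsBelow_mono k t (h + l) (show j ≤ j + 1 by omega)
    rw [up_mem_halvedHexagon]
    refine ⟨by omega, ?_⟩
    rintro m hm - ⟨h1, rfl⟩
    have := stepsBelow_stepHeight_add_one k t _ hm
    omega
  · intro i j hij
    rw [up_mem_halvedHexagon] at hij
    obtain ⟨h1, h2⟩ := hij
    by_cases hd : (stepsBelow k t (h + l) (j + 1) : ℤ) ≤ i + j + 1
    · left
      rw [down_mem_halvedHexagon]
      omega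
    -- With no left neighbour in the region, the left edge of the triangle is a step. It is the end
    -- of a path if its label is some `a q`; otherwise the triangle would be a removed dent.
    · right
      have h3 := stepsBelow_add_one_le k t (h + l) j
      rcases stepsBelow_add_one k t (h + l) j with h4 | ⟨m, hm, rfl⟩
      · omega
      · have h5 := stepsBelow_stepHeight_add_one k t _ hm
        have h6 := stepsBelow_stepHeight k t _ hm
        by_cases hq : ∃ q ∈ Icc 1 l, m = a q
        · obtain ⟨q, hq, rfl⟩ := hq
          rw [mem_Icc] at hq
          have e : q - 1 + 1 = q := by omega
          refine ⟨⟨q - 1, by omega⟩, ?_, ?_⟩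
          · rw [hN]
            simp only [e]
            omega
          · rw [hs]
            simp only [e]
        · push Not at hq
          exact absurd ⟨by omega, rfl⟩ (h2 m hm hq)
  · intro m hm
    rw [hN, hs, up_mem_halvedHexagon]
    have h1 := stepsBelow_stepHeight k t _ (hmemIcc m)
    have h2 := stepHeight_add_one_le k t h l (hmemIcc m)
    have h3 := mem_Icc.1 (hmemIcc m)
    have h4 := hN m
    have h5 := hs m
    refine ⟨⟨by omega, by omega, by omega, by omega, by omega⟩, ?_⟩
    rintro m' hm' hne ⟨-, he⟩
    exact hne _ (mem_Icc.2 (hmem m)) ((stepHeight_strictMono k t).injective he).symm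
  · intro m j hj
    rw [hN, down_mem_halvedHexagon] at hj
    rw [hs]
    by_contra hcon
    have h1 := sub_stepsBelow_mono k t (h + l) (show j + 1 ≤ stepHeight k t (a (m + 1)) + 1 by omega)
    rw [stepsBelow_stepHeight_add_one k t _ (hmemIcc m)] at h1
    omega
  · intro i j hij
    rw [up_mem_halvedHexagon] at hij
    rw [down_mem_halvedHexagon]
    have := stepsBelow_add_one_le k t (h + l) j
    omega
  · intro i j hij
    rw [up_mem_halvedHexagon] at hij
    rw [down_mem_halvedHexagon, sub_add_cancel]
    omega
  · intro j hj
    rw [down_mem_halvedHexagon] at hj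
    omega
  · intro m hm
    have h3 := mem_Icc.1 (hmemIcc m)
    have e : (k + 1) * (a (m + 1) - 1) = k * (a (m + 1) - 1) + (a (m + 1) - 1) := by ring
    rw [e]
    omega

end HalvedHexagon

/-! ### The product formula -/

theorem theorem1p1 (k x t h l : ℕ) (a : ℕ → ℕ)
    (ha : StrictMonoOn a (Set.Icc 1 l))
    (ha_mem : ∀ i ∈ Set.Icc 1 l, a i ∈ Set.Icc 1 (h + l))
    (ha_last : a (l + 1) = l + h + 1) :
    (HalvedHexagon.tilingCount (HalvedHexagon.halvedHexagon k x t h l a) : ℚ) =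
      HalvedHexagon.Phi k a l t x h *
        ∏ i ∈ Finset.Icc 1 l,
          HalvedHexagon.Phi k a i t ((a (i + 1) : ℤ) - a i - 1) ((a i : ℤ) - i) := by
  have ha' : ∀ i ∈ Finset.Icc 1 l, 1 ≤ a i ∧ a i ≤ h + l := fun i hi =>
    ha_mem i (Finset.mem_Icc.1 hi)
  have hmono : StrictMonoOn a (Set.Icc 1 (l + 1)) := by
    rintro i ⟨hi1, hi2⟩ j ⟨hj1, hj2⟩ hij
    rcases Nat.lt_or_ge l j with hj | hj
    · obtain rfl : j = l + 1 := by omega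
      have := (ha_mem i ⟨hi1, by omega⟩).2
      omega
    · exact ha ⟨hi1, by omega⟩ ⟨hj1, hj⟩ hij
  have ha1 : 1 ≤ a 1 := by
    rcases Nat.eq_zero_or_pos l with rfl | hl
    · rw [Nat.zero_add] at ha_last
      omega
    · exact (ha_mem 1 ⟨le_rfl, hl⟩).1
  rw [HalvedHexagon.prod_Phi_eq_tilingProd k t a l hmono ha1,
    show a (l + 1) - (l + 1) = h by omega, HalvedHexagon.Phi_mul_tilingProd k t a l x h ha',
    (HalvedHexagon.isPathRegion_halvedHexagon k x t h l a ha ha_mem).tilingCount_eq_pathDet]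
  exact HalvedHexagon.pathDet_eq_tilingProd k t l (x + h) a fun i hi =>
    ⟨(ha' i hi).1, by have := (ha' i hi).2; omega⟩
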